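/- **Setting.** Let $n\ge 1$ agents minimize $f(x)=\frac1n\sum_{i=1}^n f_i(x)$ over $x\in\mathbb R^d$, where $f_i(x)=\mathbb E_{\xi_i}[F_i(x;\xi_i)]$, each $f_i$ is continuously differentiable with $L$-Lipschitz gradient ($L>0$), and $f$ is bounded below with $f^*=\inf f$. Let $W^{(0)},\dots,W^{(\tau-1)}\in\mathbb R^{n\times n}$ ($\tau\ge1$) be doubly stochastic with $W^{(\tau-1)}\cdots W^{(1)}W^{(0)}=\frac1n\mathbf 1\mathbf 1^{\mathsf T}$ (finite-time consensus). Write $\mathbf x=(x_1,\dots,x_n)$, $\bar x=\frac1n\sum_i x_i$, $\bar{\mathbf x}=(\bar x,\dots,\bar x)$, $\nabla\mathbf F(\mathbf x;\boldsymbol\xi)=(\nabla F_i(x_i;\xi_i))_{i}$, $\overline{\nabla f}(\mathbf x)=\frac1n\sum_i\nabla f_i(x_i)$, and let an $n\times n$ matrix act on $(\mathbb R^d)^n$ blockwise. GT-FT with step size $\alpha$ is: $\mathbf g^{(0)}=\nabla\mathbf F(\mathbf x^{(0)};\boldsymbol\xi^{(0)})$ and, for $k\ge0$, $$\mathbf x^{(k+1)}=W^{(k\bmod\tau)}(\mathbf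 x^{(k)}-\alpha\mathbf g^{(k)}),\qquad \mathbf g^{(k+1)}=W^{(k\bmod\tau)}\mathbf g^{(k)}+\nabla\mathbf F(\mathbf x^{(k+1)};\boldsymbol\xi^{(k+1)})-\nabla\mathbf F(\mathbf x^{(k)};\boldsymbol\xi^{(k)}).$$ A *warm-up strategy* may replace the communication of the first period: for $k<\tau$ the matrix $W^{(k\bmod\tau)}$ may be replaced by any doubly stochastic $V^{(k)}$, and for $k\le\tau$ the newly computed $\mathbf g^{(k)}$ may be multiplied by any doubly stochastic $U^{(k)}$ (AllReduce is $V^{(k)}=\frac1n\mathbf 1\mathbf 1^{\mathsf T}$, respectively $U^{(k)}=\frac1n\mathbf 1\mathbf 1^{\mathsf T}$; no warm-up is $V^{(k)}=W^{(k)}$, $U^{(k)}=I$). The samples $\xi_i^{(k)}$ ($k\in\mathbb N$, $1\le i\le n$) are independent of each other and of $\mathbf x^{(0)}$, and with $\mathcal F^{(k)}=\sigma(\mathbf x^{(0)},\dots,\mathbf x^{(k)})$ and some $\sigma>0$, for all $k$ and $i$, $$\mathbb E[\nabla F_i(x_i^{(k)};\xi_i^{(k)})-\nabla f_i(x_i^{(k)})\mid\mathcal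 F^{(k)}]=0,\qquad \mathbb E[\|\nabla F_i(x_i^{(k)};\xi_i^{(k)})-\nabla f_i(x_i^{(k)})\|^2\mid\mathcal F^{(k)}]\le\sigma^2 .$$ **Corollary.** For every $\Delta$ there are constants $\gamma_7,\gamma_8,\gamma_9>0$, depending only on $\Delta$, such that the following holds for all $n,d,\tau,L,\sigma$, all data as above with $\mathbb E[f(\bar x^{(0)})-f^*]\le\Delta$, and all integers $T\ge\tau$. Let $$\alpha=\min\Big\{\big(\tfrac{c_0}{c_1T}\big)^{1/2},\big(\tfrac{c_0}{c_2T}\big)^{1/3},\tfrac1{2L},\tfrac1{4\sqrt3\,\tau^2L}\Big\},\qquad c_0=1,\quad c_1=\tfrac{L\sigma^2}{n},\quad c_2=\tau^3L^2\sigma^2,$$ and suppose that the warm-up strategy ensures $\sum_{k=0}^{\tau}\mathbb E\|\mathbf x^{(k)}-\bar{\mathbf x}^{(k)}\|^2=0$. Then the iterates of GT-FT with this warm-up satisfy $$\frac1{T+1}\sum_{k=0}^{T}\Big(\mathbb E\|\overline{\nabla f}(\mathbf x^{(k)})\|^2+\mathbb E\|\nabla f(\bar x^{(k)})\|^2\Big)\le\frac{\gamma_7\tau^2L}{T}+\gamma_8\,\tau\Big(\frac{L\sigma}{T}\Big)^{2/3}+\gamma_9\Big(\frac{L\sigma^2}{nT}\Big)^{1/2}.$$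 -/

import Mathlib

open MeasureTheory ProbabilityTheory
open scoped ENNReal

namespace GTFT

/-- The parameter space `ℝ^d` with its Euclidean norm. -/
abbrev Vec (d : ℕ) : Type := EuclideanSpace ℝ (Fin d)

/-- The average `(1/n) ∑ i, v i` of the vectors held by the `n` agents. -/
noncomputable def avg {n d : ℕ} (v : Fin n → Vec d) : Vec d :=
  (n : ℝ)⁻¹ • ∑ i, v i

/-- The action of `A ⊗ I_d` on stacked vectors: agent `i` receives `∑ j, A i j • v j`. -/
noncomputable def mix {n d : ℕ} (A : Matrix (Fin n) (Fin n) ℝ) (v : Fin n → Vec d) :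
    Fin n → Vec d :=
  fun i => ∑ j, A i j • v j

/-! ### Finite-time consensus -/

/-- The product `W (m - 1) * ⋯ * W 1 * W 0`. -/
def sweep {n : ℕ} (W : ℕ → Matrix (Fin n) (Fin n) ℝ) : ℕ → Matrix (Fin n) (Fin n) ℝ
  | 0 => 1
  | m + 1 => W m * sweep W m

/-- `W 0, …, W (τ - 1)` are doubly stochastic and
`W (τ - 1) * ⋯ * W 1 * W 0 = (1/n) 𝟙 𝟙ᵀ`.  The matrices `W l` with `τ ≤ l` play no role. -/
structure FiniteTimeConsensus {n : ℕ} (τ : ℕ) (W : ℕ → Matrix (Fin n) (Fin n) ℝ) : Prop where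
  one_le : 1 ≤ τ
  doublyStochastic : ∀ l < τ, W l ∈ doublyStochastic ℝ (Fin n)
  sweep_eq : sweep W τ = Matrix.of fun _ _ => (n : ℝ)⁻¹

/-! ### The optimization problem -/

/-- The local objective `f_i x = 𝔼 [F_i (x; ξ_i)]`, where `ξ_i` has law `P i`. -/
noncomputable def localObj {n d : ℕ} {Ξ : Fin n → Type*} [∀ i, MeasurableSpace (Ξ i)]
    (P : ∀ i, Measure (Ξ i)) (F : ∀ i, Vec d → Ξ i → ℝ) (i : Fin n) (x : Vec d) : ℝ :=
  ∫ ζ, F i x ζ ∂(P i)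

/-- The global objective `f x = (1/n) ∑ i, f_i x`. -/
noncomputable def obj {n d : ℕ} {Ξ : Fin n → Type*} [∀ i, MeasurableSpace (Ξ i)]
    (P : ∀ i, Measure (Ξ i)) (F : ∀ i, Vec d → Ξ i → ℝ) (x : Vec d) : ℝ :=
  (n : ℝ)⁻¹ * ∑ i, localObj P F i x

/-- Stacked true gradients: `∇ f_i (x_i)` for each agent `i`. -/
noncomputable def trueGrad {n d : ℕ} {Ξ : Fin n → Type*} [∀ i, MeasurableSpace (Ξ i)]
    (P : ∀ i, Measure (Ξ i)) (F : ∀ i, Vec d → Ξ i → ℝ) (x : Fin n → Vec d) : Fin n → Vec d :=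
  fun i => gradient (localObj P F i) (x i)

/-- Stacked stochastic gradients: `∇ F_i (x_i; ζ_i)` (gradient in the first variable). -/
noncomputable def stochGrad {n d : ℕ} {Ξ : Fin n → Type*}
    (F : ∀ i, Vec d → Ξ i → ℝ) (x : Fin n → Vec d) (ζ : ∀ i, Ξ i) : Fin n → Vec d :=
  fun i => gradient (fun y => F i y (ζ i)) (x i)

/-- The regularity that is implicit in writing `𝔼 [F_i (x; ξ_i)]` and `∇ F_i (x; ξ_i)`. -/
structure LossRegular {n d : ℕ} {Ξ : Fin n → Type*} [∀ i, MeasurableSpace (Ξ i)]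
    (P : ∀ i, Measure (Ξ i)) (F : ∀ i, Vec d → Ξ i → ℝ) : Prop where
  measurable : ∀ i, Measurable fun p : Vec d × Ξ i => F i p.1 p.2
  differentiable : ∀ i (ζ : Ξ i), Differentiable ℝ fun x => F i x ζ
  integrable : ∀ i x, Integrable (F i x) (P i)

/-- Every `f_i` is continuously differentiable with `L`-Lipschitz gradient, and `f` is bounded
below. -/
structure SmoothProblem {n d : ℕ} {Ξ : Fin n → Type*} [∀ i, MeasurableSpace (Ξ i)]
    (P : ∀ i, Measure (Ξ i)) (F : ∀ i, Vec d → Ξ i → ℝ) (L : ℝ) : Prop where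
  pos : 0 < L
  contDiff : ∀ i, ContDiff ℝ 1 (localObj P F i)
  lipschitz : ∀ i x y,
    ‖gradient (localObj P F i) x - gradient (localObj P F i) y‖ ≤ L * ‖x - y‖
  bddBelow : BddBelow (Set.range (obj P F))

/-- The optimal value `f* = inf f`. -/
noncomputable def optVal {n d : ℕ} {Ξ : Fin n → Type*} [∀ i, MeasurableSpace (Ξ i)]
    (P : ∀ i, Measure (Ξ i)) (F : ∀ i, Vec d → Ξ i → ℝ) : ℝ :=
  ⨅ x, obj P F x

/-! ### The algorithm -/

/-- One sample path of gradient tracking: the pair `(x^(k), g^(k))` of stacked parameters and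
tracking variables, with mixing matrices `A k`, and with an additional averaging `B k` of the
tracking variables after they have been computed (`B k = 1` means no additional averaging):

* `g^(0) = B 0 (∇F(x^(0); ξ^(0)))`,
* `x^(k+1) = A k (x^(k) - α g^(k))`,
* `g^(k+1) = B (k+1) (A k g^(k) + ∇F(x^(k+1); ξ^(k+1)) - ∇F(x^(k); ξ^(k)))`. -/
noncomputable def gradTracking {n d : ℕ} {Ξ : Fin n → Type*} (F : ∀ i, Vec d → Ξ i → ℝ)
    (A B : ℕ → Matrix (Fin n) (Fin n) ℝ) (α : ℝ) (x₀ : Fin n → Vec d) (ζ : ℕ → ∀ i, Ξ i) :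
    ℕ → (Fin n → Vec d) × (Fin n → Vec d)
  | 0 => (x₀, mix (B 0) (stochGrad F x₀ (ζ 0)))
  | k + 1 =>
    let p := gradTracking F A B α x₀ ζ k
    let x := mix (A k) (p.1 - α • p.2)
    (x, mix (B (k + 1))
      (mix (A k) p.2 + stochGrad F x (ζ (k + 1)) - stochGrad F p.1 (ζ k)))

/-- Mixing matrix of iteration `k`: the warm-up matrix `V k` in the first period `k < τ`, and
`W (k mod τ)` afterwards. -/
def mixSchedule {n : ℕ} (τ : ℕ) (V W : ℕ → Matrix (Fin n) (Fin n) ℝ) (k : ℕ) :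
    Matrix (Fin n) (Fin n) ℝ :=
  if k < τ then V k else W (k % τ)

/-- Additional averaging of the tracking variable `g^(k)`: the warm-up matrix `U k` for `k ≤ τ`,
and none afterwards. -/
def trackSchedule {n : ℕ} (τ : ℕ) (U : ℕ → Matrix (Fin n) (Fin n) ℝ) (k : ℕ) :
    Matrix (Fin n) (Fin n) ℝ :=
  if k ≤ τ then U k else 1

/-- The iterates `x^(k)` of GT-FT (gradient tracking which cycles through `W 0, …, W (τ - 1)`)
whose communication in the first period is governed by a warm-up strategy `V, U`.

* `V k = W k` and `U k = 1`: plain GT-FT, without any warm-up.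
* `V k = (1/n) 𝟙 𝟙ᵀ`: AllReduce of the parameters, for `k < τ`.
* `U k = (1/n) 𝟙 𝟙ᵀ`: AllReduce of the tracking variables, for `k ≤ τ`. -/
noncomputable def iterates {n d : ℕ} {Ξ : Fin n → Type*} {Ω : Type*} (F : ∀ i, Vec d → Ξ i → ℝ)
    (τ : ℕ) (W V U : ℕ → Matrix (Fin n) (Fin n) ℝ) (α : ℝ) (x₀ : Ω → Fin n → Vec d)
    (ξ : ℕ → ∀ i, Ω → Ξ i) (k : ℕ) (ω : Ω) : Fin n → Vec d :=
  (gradTracking F (mixSchedule τ V W) (trackSchedule τ U) α (x₀ ω) (fun j i => ξ j i ω) k).1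

/-- The `σ`-algebra `ℱ^(k)` generated by the initial condition `x 0` and by `x 1, …, x k`. -/
@[reducible] def history {n d : ℕ} {Ω : Type*} (x : ℕ → Ω → Fin n → Vec d) (k : ℕ) : MeasurableSpace Ω :=
  ⨆ j ∈ Finset.range (k + 1), MeasurableSpace.comap (x j) inferInstance

/-- Gradient noise `∇F_i (x_i^(k); ξ_i^(k)) - ∇f_i (x_i^(k))` of agent `i` at iteration `k`. -/
noncomputable def noise {n d : ℕ} {Ξ : Fin n → Type*} [∀ i, MeasurableSpace (Ξ i)] {Ω : Type*}
    (P : ∀ i, Measure (Ξ i)) (F : ∀ i, Vec d → Ξ i → ℝ) (x : ℕ → Ω → Fin n → Vec d)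
    (ξ : ℕ → ∀ i, Ω → Ξ i) (k : ℕ) (i : Fin n) (ω : Ω) : Vec d :=
  stochGrad F (x k ω) (fun i => ξ k i ω) i - trueGrad P F (x k ω) i

/-- The sampling assumption along the iterates `x`: the samples `ξ k i` are independent of each
other and of the initial condition, and given `ℱ^(k)` the stochastic gradients are unbiased with
variance at most `σ²`. -/
structure NoiseAssumption {n d : ℕ} {Ξ : Fin n → Type*} [∀ i, MeasurableSpace (Ξ i)]
    {Ω : Type*} [MeasurableSpace Ω] (μ : Measure Ω)
    (P : ∀ i, Measure (Ξ i)) (F : ∀ i, Vec d → Ξ i → ℝ) (x : ℕ → Ω → Fin n → Vec d)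
    (ξ : ℕ → ∀ i, Ω → Ξ i) (σ : ℝ) : Prop where
  pos : 0 < σ
  measurable_init : Measurable (x 0)
  measurable_sample : ∀ k i, Measurable (ξ k i)
  indep : iIndepFun (fun p : ℕ × Fin n => ξ p.1 p.2) μ
  indep_init : IndepFun (x 0) (fun ω (p : ℕ × Fin n) => ξ p.1 p.2 ω) μ
  memLp : ∀ k i, MemLp (noise P F x ξ k i) 2 μ
  unbiased : ∀ k i, μ[noise P F x ξ k i | history x k] =ᵐ[μ] 0
  variance : ∀ k i, μ[fun ω => ‖noise P F x ξ k i ω‖ ^ 2 | history x k] ≤ᵐ[μ] fun _ => σ ^ 2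

/-- The expected squared norm `𝔼 ‖X‖²`, as an extended nonnegative number. -/
noncomputable def meanSq {Ω : Type*} [MeasurableSpace Ω] {d : ℕ} (μ : Measure Ω)
    (X : Ω → Vec d) : ℝ≥0∞ :=
  ∫⁻ ω, ‖X ω‖ₑ ^ 2 ∂μ

/-- The consensus error `𝔼 ‖x - x̄‖² = ∑ i, 𝔼 ‖x_i - x̄‖²`. -/
noncomputable def consensusError {Ω : Type*} [MeasurableSpace Ω] {n d : ℕ} (μ : Measure Ω)
    (x : Ω → Fin n → Vec d) : ℝ≥0∞ :=
  ∑ i, meanSq μ fun ω => x ω i - avg (x ω)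

/-- The step size
`min {(c₀/(c₁ T))^(1/2), (c₀/(c₂ T))^(1/3), 1/(2L), 1/(4√3 τ² L)}` with
`c₀ = 1`, `c₁ = L σ² / n`, `c₂ = τ³ L² σ²`. -/
noncomputable def stepSize (n τ T : ℕ) (L σ : ℝ) : ℝ :=
  let c₀ : ℝ := 1
  let c₁ : ℝ := L * σ ^ 2 / n
  let c₂ : ℝ := (τ : ℝ) ^ 3 * L ^ 2 * σ ^ 2
  min (min ((c₀ / (c₁ * T)) ^ (1 / 2 : ℝ)) ((c₀ / (c₂ * T)) ^ (1 / 3 : ℝ)))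
    (min (1 / (2 * L)) (1 / (4 * Real.sqrt 3 * (τ : ℝ) ^ 2 * L)))

end GTFT

/-! Since every mixing matrix is doubly stochastic, the average of the tracking variables is always
the average of the current stochastic gradients, and the averaged iterate performs plain stochastic
gradient descent with noise variance `σ ^ 2 / n`. The descent lemma (`SmoothProblem.obj_step_le`,
`TrackedRun.integral_obj_step_le`) then bounds the gradients, up to an error proportional to the
consensus error. The task is to control that error.

Agreement of the parameters at iterations `τ - 1` and `τ` forces the mixed deviation of the tracking
variable to vanish, so the deviations restart from zero. Unrolling both recursions
(`parameter_unroll`) writes the deviation of the parameters as `-α` times a sum of past gradient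
increments, an increment of age `m` carrying the weight `m` and a product of `m` mixing matrices. A
product of length at least `2 * τ` contains a complete sweep and annihilates deviations, so only
ages below `2 * τ` survive (`IsTracking.cen_eq`).

The increments of true gradients are bounded by Cauchy–Schwarz, at the price of the square of the
total weight, of order `τ ^ 4`. The noises are pairwise orthogonal, so they cost only the sum of the
squared weights, of order `τ ^ 3` (`TrackedRun.integral_nsq_cen_le`). The increments of the iterates
are in turn bounded by consensus errors and averaged gradients (`TrackedRun.integral_nsq_sub_le`).
The condition `α ^ 2 * L ^ 2 * τ ^ 4 ≤ 1 / 48` closes this loop (`sum_consensus_le`). Summing the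
descent inequalities gives a bound of the form `Δ / (α * T) + c₁ * α + c₂ * α ^ 2` up to constants
(`sum_gradients_le`), which the chosen step size balances. -/

namespace GTFT

/-! ### Stacked vectors -/

section Linear

variable {n d : ℕ}

/-- The squared Euclidean norm of a stacked vector. -/
noncomputable def nsq (v : Fin n → Vec d) : ℝ := ∑ i, ‖v i‖ ^ 2

/-- The deviation of a stacked vector from its average. -/
noncomputable def cen (v : Fin n → Vec d) : Fin n → Vec d := fun i => v i - avg v

lemma nsq_nonneg (v : Fin n → Vec d) : 0 ≤ nsq v :=
  Finset.sum_nonneg fun _ _ => sq_nonneg _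

lemma nsq_zero : nsq (0 : Fin n → Vec d) = 0 := by simp [nsq]

lemma nsq_smul (c : ℝ) (v : Fin n → Vec d) : nsq (c • v) = c ^ 2 * nsq v := by
  simp [nsq, norm_smul, mul_pow, Finset.mul_sum]

lemma nsq_neg (v : Fin n → Vec d) : nsq (-v) = nsq v := by
  simp [nsq]

lemma norm_add_sq_le_two {E : Type*} [SeminormedAddCommGroup E] (u v : E) :
    ‖u + v‖ ^ 2 ≤ 2 * ‖u‖ ^ 2 + 2 * ‖v‖ ^ 2 := by
  have h := norm_add_le u v
  have h0 := norm_nonneg (u + v)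
  nlinarith [sq_nonneg (‖u‖ - ‖v‖)]

lemma nsq_add_le (u v : Fin n → Vec d) : nsq (u + v) ≤ 2 * nsq u + 2 * nsq v := by
  simp only [nsq, Finset.mul_sum, ← Finset.sum_add_distrib]
  exact Finset.sum_le_sum fun i _ => norm_add_sq_le_two _ _

lemma nsq_sub_le (u v : Fin n → Vec d) : nsq (u - v) ≤ 2 * nsq u + 2 * nsq v := by
  rw [sub_eq_add_neg]
  simpa [nsq_neg] using nsq_add_le u (-v)

/-- Cauchy–Schwarz with weights. It serves for averages, for rows of doubly stochastic matrices and,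
through `nsq_sum_smul_le`, for the weights `lag`. -/
lemma norm_sum_smul_sq_le {ι E : Type*} [SeminormedAddCommGroup E] [NormedSpace ℝ E]
    (s : Finset ι) (w : ι → ℝ) (hw : ∀ i ∈ s, 0 ≤ w i) (y : ι → E) :
    ‖∑ i ∈ s, w i • y i‖ ^ 2 ≤ (∑ i ∈ s, w i) * ∑ i ∈ s, w i * ‖y i‖ ^ 2 := by
  have h1 : ‖∑ i ∈ s, w i • y i‖ ≤ ∑ i ∈ s, w i * ‖y i‖ := by
    refine (norm_sum_le _ _).trans (Finset.sum_le_sum fun i hi => ?_)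
    rw [norm_smul, Real.norm_of_nonneg (hw i hi)]
  refine (pow_le_pow_left₀ (norm_nonneg _) h1 2).trans ?_
  exact Finset.sum_sq_le_sum_mul_sum_of_sq_le_mul s hw
    (fun i hi => mul_nonneg (hw i hi) (sq_nonneg _)) fun i _ => le_of_eq (by ring)

lemma nsq_sum_smul_le {ι : Type*} (s : Finset ι) (w : ι → ℝ) (hw : ∀ i ∈ s, 0 ≤ w i)
    (y : ι → Fin n → Vec d) :
    nsq (∑ i ∈ s, w i • y i) ≤ (∑ i ∈ s, w i) * ∑ i ∈ s, w i * nsq (y i) := by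
  have : (∑ i ∈ s, w i) * ∑ i ∈ s, w i * nsq (y i)
      = ∑ a, (∑ i ∈ s, w i) * ∑ i ∈ s, w i * ‖y i a‖ ^ 2 := by
    simp only [nsq, Finset.mul_sum]
    rw [Finset.sum_comm]
  rw [this]
  refine Finset.sum_le_sum fun a _ => ?_
  simpa [Finset.sum_apply] using norm_sum_smul_sq_le s w hw fun i => y i a

lemma norm_avg_sq_le (v : Fin n → Vec d) : ‖avg v‖ ^ 2 ≤ (n : ℝ)⁻¹ * nsq v := by
  have h := norm_sum_smul_sq_le Finset.univ (fun _ : Fin n => (n : ℝ)⁻¹)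
    (fun _ _ => by positivity) v
  rw [← Finset.smul_sum, ← Finset.mul_sum] at h
  refine h.trans ?_
  rcases Nat.eq_zero_or_pos n with rfl | hn
  · simp
  · have : (n : ℝ) ≠ 0 := by positivity
    simp [nsq, this]

lemma avg_add (u v : Fin n → Vec d) : avg (u + v) = avg u + avg v := by
  simp [avg, Finset.sum_add_distrib]

lemma avg_sub (u v : Fin n → Vec d) : avg (u - v) = avg u - avg v := by
  simp [avg, Finset.sum_sub_distrib, smul_sub]

lemma avg_smul (c : ℝ) (v : Fin n → Vec d) : avg (c • v) = c • avg v := by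
  simp [avg, ← Finset.smul_sum, smul_comm c]

lemma avg_const (hn : 1 ≤ n) (y : Vec d) : avg (fun _ : Fin n => y) = y := by
  have : (n : ℝ) ≠ 0 := by positivity
  simp [avg, ← Nat.cast_smul_eq_nsmul ℝ, smul_smul, this]

lemma cen_add (u v : Fin n → Vec d) : cen (u + v) = cen u + cen v := by
  ext1 i; simp only [cen, Pi.add_apply, avg_add]; abel

lemma cen_sub (u v : Fin n → Vec d) : cen (u - v) = cen u - cen v := by
  ext1 i; simp only [cen, Pi.sub_apply, avg_sub]; abel

lemma cen_smul (c : ℝ) (v : Fin n → Vec d) : cen (c • v) = c • cen v := by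
  ext1 i; simp only [cen, Pi.smul_apply, avg_smul, smul_sub]

lemma avg_cen (hn : 1 ≤ n) (v : Fin n → Vec d) : avg (cen v) = 0 := by
  have : cen v = v - fun _ => avg v := rfl
  rw [this, avg_sub, avg_const hn, sub_self]

lemma sum_eq_smul_avg (hn : 1 ≤ n) (v : Fin n → Vec d) : ∑ i, v i = (n : ℝ) • avg v := by
  have : (n : ℝ) ≠ 0 := by positivity
  simp [avg, smul_smul, this]

/-- Pythagoras: deviations sum to zero, hence are orthogonal to constant stacks. -/
lemma nsq_eq_cen_add (hn : 1 ≤ n) (v : Fin n → Vec d) :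
    nsq v = nsq (cen v) + n * ‖avg v‖ ^ 2 := by
  have h : ∀ i, ‖v i‖ ^ 2 = ‖cen v i‖ ^ 2 + 2 * inner ℝ (cen v i) (avg v) + ‖avg v‖ ^ 2 := by
    intro i
    rw [← norm_add_sq_real]; simp [cen]
  simp only [nsq]
  rw [Finset.sum_congr rfl fun i _ => h i, Finset.sum_add_distrib, Finset.sum_add_distrib,
    ← Finset.mul_sum, ← sum_inner, sum_eq_smul_avg hn, avg_cen hn]
  simp

lemma nsq_cen_le (hn : 1 ≤ n) (v : Fin n → Vec d) : nsq (cen v) ≤ nsq v := by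
  rw [nsq_eq_cen_add hn v]
  have : 0 ≤ (n : ℝ) * ‖avg v‖ ^ 2 := by positivity
  linarith

/-! ### Mixing by doubly stochastic matrices and their products. -/

lemma mix_add (A : Matrix (Fin n) (Fin n) ℝ) (u v : Fin n → Vec d) :
    mix A (u + v) = mix A u + mix A v := by
  ext1 i; simp [mix, Finset.sum_add_distrib]

lemma mix_sub (A : Matrix (Fin n) (Fin n) ℝ) (u v : Fin n → Vec d) :
    mix A (u - v) = mix A u - mix A v := by
  ext1 i; simp [mix, Finset.sum_sub_distrib, smul_sub]

lemma mix_smul (A : Matrix (Fin n) (Fin n) ℝ) (c : ℝ) (v : Fin n → Vec d) :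
    mix A (c • v) = c • mix A v := by
  ext1 i; simp [mix, Finset.smul_sum, smul_comm c]

lemma mix_zero (A : Matrix (Fin n) (Fin n) ℝ) : mix A (0 : Fin n → Vec d) = 0 := by
  ext1 i; simp [mix]

lemma mix_sum {ι : Type*} (A : Matrix (Fin n) (Fin n) ℝ) (s : Finset ι)
    (v : ι → Fin n → Vec d) : mix A (∑ i ∈ s, v i) = ∑ i ∈ s, mix A (v i) := by
  classical
  induction s using Finset.induction_on with
  | empty => simp [mix_zero]
  | insert a s ha ih => rw [Finset.sum_insert ha, Finset.sum_insert ha, mix_add, ih]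

lemma mix_one (v : Fin n → Vec d) : mix 1 v = v := by
  ext1 i; simp [mix, Matrix.one_apply, ite_smul]

lemma mix_mul (A B : Matrix (Fin n) (Fin n) ℝ) (v : Fin n → Vec d) :
    mix (A * B) v = mix A (mix B v) := by
  ext1 i
  simp only [mix, Matrix.mul_apply, Finset.sum_smul, Finset.smul_sum, smul_smul]
  rw [Finset.sum_comm]

lemma mix_average (v : Fin n → Vec d) :
    mix (Matrix.of fun _ _ => (n : ℝ)⁻¹) v = fun _ => avg v := by
  ext1 i; simp [mix, avg, Finset.smul_sum]

lemma mix_const {A : Matrix (Fin n) (Fin n) ℝ} (hA : A ∈ doublyStochastic ℝ (Fin n))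
    (y : Vec d) : mix A (fun _ => y) = fun _ => y := by
  ext1 i; simp [mix, ← Finset.sum_smul, sum_row_of_mem_doublyStochastic hA]

lemma avg_mix {A : Matrix (Fin n) (Fin n) ℝ} (hA : A ∈ doublyStochastic ℝ (Fin n))
    (v : Fin n → Vec d) : avg (mix A v) = avg v := by
  simp only [avg, mix]
  rw [Finset.sum_comm]
  simp [← Finset.sum_smul, sum_col_of_mem_doublyStochastic hA]

lemma cen_mix {A : Matrix (Fin n) (Fin n) ℝ} (hA : A ∈ doublyStochastic ℝ (Fin n))
    (v : Fin n → Vec d) : cen (mix A v) = mix A (cen v) := by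
  have h1 : cen v = v - fun _ => avg v := rfl
  have h2 : cen (mix A v) = mix A v - fun _ => avg (mix A v) := rfl
  rw [h1, h2, mix_sub, mix_const hA, avg_mix hA]

/-- Row sums equal to one give convexity of the squared norm in each block; column sums equal to one
then restore the total. -/
lemma nsq_mix_le {A : Matrix (Fin n) (Fin n) ℝ} (hA : A ∈ doublyStochastic ℝ (Fin n))
    (v : Fin n → Vec d) : nsq (mix A v) ≤ nsq v := by
  have h : ∀ i, ‖mix A v i‖ ^ 2 ≤ ∑ j, A i j * ‖v j‖ ^ 2 := by
    intro i
    have := norm_sum_smul_sq_le Finset.univ (A i)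
      (fun j _ => nonneg_of_mem_doublyStochastic hA) v
    rwa [sum_row_of_mem_doublyStochastic hA, one_mul] at this
  refine (Finset.sum_le_sum fun i _ => h i).trans_eq ?_
  rw [Finset.sum_comm]
  simp [← Finset.sum_mul, sum_col_of_mem_doublyStochastic hA, nsq]

lemma sweep_mem (W : ℕ → Matrix (Fin n) (Fin n) ℝ) (hW : ∀ l, W l ∈ doublyStochastic ℝ (Fin n))
    (m : ℕ) : sweep W m ∈ doublyStochastic ℝ (Fin n) := by
  induction m with
  | zero => exact one_mem _
  | succ m ih => exact mul_mem (hW m) ih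

lemma sweep_add (W : ℕ → Matrix (Fin n) (Fin n) ℝ) (a b : ℕ) :
    sweep W (a + b) = sweep (fun l => W (a + l)) b * sweep W a := by
  induction b with
  | zero => simp [sweep]
  | succ b ih => rw [← add_assoc, sweep, ih, sweep, mul_assoc]

lemma sweep_congr {W W' : ℕ → Matrix (Fin n) (Fin n) ℝ} (m : ℕ) (h : ∀ l < m, W l = W' l) :
    sweep W m = sweep W' m := by
  induction m with
  | zero => rfl
  | succ m ih => rw [sweep, sweep, h m (by omega), ih fun l hl => h l (by omega)]

lemma mix_average_cen (hn : 1 ≤ n) (v : Fin n → Vec d) :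
    mix (Matrix.of fun _ _ => (n : ℝ)⁻¹) (cen v) = 0 := by
  rw [mix_average, avg_cen hn]; rfl

/-- Two consecutive periods contain a full sweep, so they annihilate deviations. -/
lemma mix_sweep_cen_eq_zero (hn : 1 ≤ n) {τ : ℕ} {W : ℕ → Matrix (Fin n) (Fin n) ℝ}
    (hW : FiniteTimeConsensus τ W) (a m : ℕ) (hm : 2 * τ ≤ m) (v : Fin n → Vec d) :
    mix (sweep (fun l => W ((a + l) % τ)) m) (cen v) = 0 := by
  have hτ := hW.one_le
  have hds : ∀ l, W (l % τ) ∈ doublyStochastic ℝ (Fin n) :=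
    fun l => hW.doublyStochastic _ (Nat.mod_lt _ hτ)
  -- Some period starts within the next `τ` steps, and the `τ` factors from there on form a complete
  -- sweep.
  obtain ⟨r, hr, hra⟩ : ∃ r ≤ τ, (a + r) % τ = 0 := by
    refine ⟨τ - a % τ, by omega, ?_⟩
    have : a + (τ - a % τ) = τ * (a / τ + 1) := by
      have h1 := Nat.div_add_mod a τ
      have h2 := Nat.mod_lt a hτ
      rw [mul_add, mul_one]; omega
    rw [this, Nat.mul_mod_right]
  obtain ⟨e, rfl⟩ : ∃ e, m = r + (τ + e) := ⟨m - r - τ, by omega⟩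
  rw [sweep_add, sweep_add, mix_mul, mix_mul]
  have h1 : sweep (fun l => W ((a + (r + l)) % τ)) τ = Matrix.of fun _ _ => (n : ℝ)⁻¹ := by
    rw [← hW.sweep_eq]
    refine sweep_congr τ fun l hl => ?_
    rw [← add_assoc, Nat.add_mod, hra, zero_add, Nat.mod_mod, Nat.mod_eq_of_lt hl]
  rw [h1, ← cen_mix (sweep_mem _ (fun l => hds _) r), mix_average_cen hn, mix_zero]

end Linear

/-! ### Unrolling gradient tracking -/

section Dynamics

variable {n d : ℕ}

lemma tracking_unroll {M : ℕ → Matrix (Fin n) (Fin n) ℝ} {G z : ℕ → Fin n → Vec d}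
    (h0 : G 0 = z 0) (hG : ∀ p, G (p + 1) = mix (M p) (G p) + z (p + 1)) (p : ℕ) :
    G p = ∑ q ∈ Finset.range (p + 1), mix (sweep (fun l => M (q + l)) (p - q)) (z q) := by
  induction p with
  | zero => simp [sweep, mix_one, h0]
  | succ p ih =>
    rw [Finset.sum_range_succ, hG, ih, mix_sum]
    congr 1
    · refine Finset.sum_congr rfl fun q hq => ?_
      have hq' : q ≤ p := by simpa [Nat.lt_succ_iff] using hq
      rw [Nat.succ_sub hq', sweep, mix_mul, Nat.add_sub_cancel' hq']
    · simp [sweep, mix_one]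

/-- The input `z q` enters `G` at time `q`, and `X` collects it from `G` once per later step. All
copies have passed through the same matrices by time `p`, so they add up to the factor `p - q`. -/
lemma parameter_unroll {M : ℕ → Matrix (Fin n) (Fin n) ℝ} {G X z : ℕ → Fin n → Vec d} {α : ℝ}
    (h0 : G 0 = z 0) (hG : ∀ p, G (p + 1) = mix (M p) (G p) + z (p + 1))
    (hX0 : X 0 = 0) (hX : ∀ p, X (p + 1) = mix (M p) (X p - α • G p)) (p : ℕ) :
    X p = -α • ∑ q ∈ Finset.range p,
      ((p - q : ℕ) : ℝ) • mix (sweep (fun l => M (q + l)) (p - q)) (z q) := by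
  induction p with
  | zero => simp [hX0]
  | succ p ih =>
    rw [hX, mix_sub, mix_smul, tracking_unroll h0 hG p, mix_sum, ih, mix_smul, mix_sum,
      neg_smul, neg_smul, ← neg_add', ← smul_add, Finset.sum_range_succ, ← add_assoc,
      ← Finset.sum_add_distrib, Finset.sum_range_succ]
    congr 3
    · refine Finset.sum_congr rfl fun q hq => ?_
      have hq' : q ≤ p := (Finset.mem_range.1 hq).le
      rw [Nat.succ_sub hq', sweep, mix_mul, Nat.add_sub_cancel' hq', mix_smul, Nat.succ_eq_add_one,
        Nat.cast_add, add_smul, Nat.cast_one, one_smul]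
    · simp [sweep, mix_one]

/-- The weight of the gradient increment of `m` iterations ago in the consensus error. -/
noncomputable def lag (τ m : ℕ) : ℝ := if m < 2 * τ then (m : ℝ) else 0

lemma lag_nonneg (τ m : ℕ) : 0 ≤ lag τ m := by unfold lag; split_ifs <;> positivity

lemma lag_le (τ m : ℕ) : lag τ m ≤ 2 * τ := by
  unfold lag
  split_ifs with h
  · exact_mod_cast h.le
  · positivity

lemma lag_zero (τ : ℕ) : lag τ 0 = 0 := by simp [lag]

lemma sum_lag_le (τ P : ℕ) : ∑ m ∈ Finset.range P, lag τ m ≤ 2 * (τ : ℝ) ^ 2 := by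
  have h1 : ∑ m ∈ Finset.range P, lag τ m ≤ ∑ m ∈ Finset.range (2 * τ), (m : ℝ) := by
    simp only [lag]
    rw [← Finset.sum_filter]
    refine Finset.sum_le_sum_of_subset_of_nonneg (fun m hm => ?_) fun _ _ _ => Nat.cast_nonneg _
    simpa using (Finset.mem_filter.1 hm).2
  have h2 : (∑ m ∈ Finset.range (2 * τ), (m : ℝ)) * 2 ≤ (2 * τ : ℝ) * (2 * τ) := by
    have := Finset.sum_range_id_mul_two (2 * τ)
    have h3 : (∑ m ∈ Finset.range (2 * τ), m) * 2 ≤ (2 * τ) * (2 * τ) := by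
      rw [this]; exact Nat.mul_le_mul_left _ (Nat.sub_le _ _)
    have h4 : ((((∑ m ∈ Finset.range (2 * τ), m) * 2 : ℕ)) : ℝ) ≤ ((2 * τ * (2 * τ) : ℕ) : ℝ) :=
      Nat.cast_le.2 h3
    push_cast at h4
    exact h4
  nlinarith

lemma sum_lag_sub_left_le (τ p : ℕ) :
    ∑ q ∈ Finset.range p, lag τ (p - q) ≤ 2 * (τ : ℝ) ^ 2 := by
  have h : ∑ q ∈ Finset.range (p + 1), lag τ (p - q) = ∑ q ∈ Finset.range (p + 1), lag τ q := by
    simpa using Finset.sum_range_reflect (lag τ) (p + 1)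
  rw [Finset.sum_range_succ, Nat.sub_self, lag_zero, add_zero] at h
  rw [h]; exact sum_lag_le _ _

/-- For `p ≤ q` the truncated difference is zero and `lag τ 0 = 0`, so only the terms with `q < p`
count. -/
lemma sum_lag_sub_right_le (τ P q : ℕ) :
    ∑ p ∈ Finset.range P, lag τ (p - q) ≤ 2 * (τ : ℝ) ^ 2 := by
  rcases le_total P q with h | h
  · rw [Finset.sum_eq_zero]
    · positivity
    · intro p hp
      rw [Nat.sub_eq_zero_of_le ((Finset.mem_range.1 hp).le.trans h), lag_zero]
  · obtain ⟨r, rfl⟩ := Nat.exists_eq_add_of_le h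
    rw [Finset.sum_range_add, Finset.sum_eq_zero, zero_add]
    · simpa using sum_lag_le τ r
    · intro p hp
      rw [Nat.sub_eq_zero_of_le (Finset.mem_range.1 hp).le, lag_zero]

/-- Each weight is at most `2 * τ` and their sum at most `2 * τ ^ 2`. This is the source of the
factor `τ ^ 3` in `c₂`. -/
lemma sum_lag_sq_le (τ p : ℕ) :
    ∑ q ∈ Finset.range p, lag τ (p - q) ^ 2 ≤ 4 * (τ : ℝ) ^ 3 := by
  have : ∑ q ∈ Finset.range p, lag τ (p - q) ^ 2
      ≤ 2 * τ * ∑ q ∈ Finset.range p, lag τ (p - q) := by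
    rw [Finset.mul_sum]
    refine Finset.sum_le_sum fun q _ => ?_
    nlinarith [lag_nonneg τ (p - q), lag_le τ (p - q)]
  nlinarith [sum_lag_sub_left_le τ p, (Nat.cast_nonneg τ : (0 : ℝ) ≤ τ)]

lemma sum_sum_lag_mul_le (τ P : ℕ) (y : ℕ → ℝ) (hy : ∀ q, 0 ≤ y q) :
    ∑ p ∈ Finset.range (P + 1), ∑ q ∈ Finset.range p, lag τ (p - q) * y q
      ≤ 2 * (τ : ℝ) ^ 2 * ∑ q ∈ Finset.range P, y q := by
  calc _ ≤ ∑ p ∈ Finset.range (P + 1), ∑ q ∈ Finset.range P, lag τ (p - q) * y q := by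
        refine Finset.sum_le_sum fun p hp => Finset.sum_le_sum_of_subset_of_nonneg ?_
          fun q _ _ => mul_nonneg (lag_nonneg _ _) (hy q)
        exact Finset.range_subset_range.2 (Nat.lt_succ_iff.1 (Finset.mem_range.1 hp))
    _ = ∑ q ∈ Finset.range P, (∑ p ∈ Finset.range (P + 1), lag τ (p - q)) * y q := by
        rw [Finset.sum_comm]; simp only [Finset.sum_mul]
    _ ≤ _ := by
        rw [Finset.mul_sum]
        exact Finset.sum_le_sum fun q _ =>
          mul_le_mul_of_nonneg_right (sum_lag_sub_right_le _ _ _) (hy q)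

/-- The sample paths of gradient tracking driven by stochastic gradients `s`. -/
structure IsTracking (A B : ℕ → Matrix (Fin n) (Fin n) ℝ) (α : ℝ)
    (x g s : ℕ → Fin n → Vec d) : Prop where
  init : g 0 = mix (B 0) (s 0)
  step_x : ∀ k, x (k + 1) = mix (A k) (x k - α • g k)
  step_g : ∀ k, g (k + 1) = mix (B (k + 1)) (mix (A k) (g k) + s (k + 1) - s k)

section

variable {A B W V U : ℕ → Matrix (Fin n) (Fin n) ℝ} {α : ℝ} {x g s : ℕ → Fin n → Vec d}

lemma IsTracking.avg_g (h : IsTracking A B α x g s) (hA : ∀ k, A k ∈ doublyStochastic ℝ (Fin n))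
    (hB : ∀ k, B k ∈ doublyStochastic ℝ (Fin n)) (k : ℕ) : avg (g k) = avg (s k) := by
  induction k with
  | zero => rw [h.init, avg_mix (hB 0)]
  | succ k ih => rw [h.step_g, avg_mix (hB _), avg_sub, avg_add, avg_mix (hA _), ih]; abel

lemma IsTracking.avg_x (h : IsTracking A B α x g s) (hA : ∀ k, A k ∈ doublyStochastic ℝ (Fin n))
    (hB : ∀ k, B k ∈ doublyStochastic ℝ (Fin n)) (k : ℕ) :
    avg (x (k + 1)) = avg (x k) - α • avg (s k) := by
  rw [h.step_x, avg_mix (hA _), avg_sub, avg_smul, h.avg_g hA hB]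

lemma mixSchedule_mem {τ : ℕ} (hW : FiniteTimeConsensus τ W)
    (hV : ∀ k < τ, V k ∈ doublyStochastic ℝ (Fin n)) (k : ℕ) :
    mixSchedule τ V W k ∈ doublyStochastic ℝ (Fin n) := by
  unfold mixSchedule
  split_ifs with h
  · exact hV k h
  · exact hW.doublyStochastic _ (Nat.mod_lt _ hW.one_le)

lemma trackSchedule_mem {τ : ℕ} (hU : ∀ k ≤ τ, U k ∈ doublyStochastic ℝ (Fin n)) (k : ℕ) :
    trackSchedule τ U k ∈ doublyStochastic ℝ (Fin n) := by
  unfold trackSchedule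
  split_ifs with h
  · exact hU k h
  · exact one_mem _

/-- If the agents agree up to the end of the warm-up period, then afterwards their deviations are
driven by the gradient increments of the last two periods. -/
lemma IsTracking.cen_eq {t : ℕ} (h : IsTracking (mixSchedule (t + 1) V W)
      (trackSchedule (t + 1) U) α x g s) (hn : 1 ≤ n) (hα : α ≠ 0)
    (hW : FiniteTimeConsensus (t + 1) W)
    (hV : ∀ k < t + 1, V k ∈ doublyStochastic ℝ (Fin n))
    (hU : ∀ k ≤ t + 1, U k ∈ doublyStochastic ℝ (Fin n))
    (h0 : cen (x t) = 0) (h1 : cen (x (t + 1)) = 0) (p : ℕ) :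
    cen (x (t + 1 + p)) = -α • ∑ q ∈ Finset.range p, lag (t + 1) (p - q) •
      mix (sweep (fun l => W ((q + l) % (t + 1))) (p - q) * trackSchedule (t + 1) U (t + 1 + q))
        (cen (s (t + q + 1) - s (t + q))) := by
  have hA := mixSchedule_mem hW hV
  have hB := trackSchedule_mem hU
  have hcx : ∀ k, cen (x (k + 1)) =
      mix (mixSchedule (t + 1) V W k) (cen (x k) - α • cen (g k)) := fun k => by
    rw [h.step_x, cen_mix (hA k), cen_sub, cen_smul]
  have hcg : ∀ k, cen (g (k + 1)) = mix (trackSchedule (t + 1) U (k + 1))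
      (mix (mixSchedule (t + 1) V W k) (cen (g k)) + cen (s (k + 1) - s k)) := fun k => by
    rw [h.step_g, cen_mix (hB _), add_sub_assoc, cen_add, cen_mix (hA k)]
  -- Two consecutive agreements of the parameters, together with `α ≠ 0`, leave no room for a mixed
  -- tracking deviation; no separate hypothesis on `g` is needed.
  have hg0 : mix (mixSchedule (t + 1) V W t) (cen (g t)) = 0 := by
    have := hcx t
    rw [h0, h1, zero_sub, ← neg_smul, mix_smul, eq_comm] at this
    exact (smul_eq_zero.1 this).resolve_left (neg_ne_zero.2 hα)
  have hM : ∀ p, mixSchedule (t + 1) V W (t + 1 + p) = W (p % (t + 1)) := fun p => by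
    simp only [mixSchedule]
    rw [if_neg (by omega), Nat.add_mod_left]
  have key := parameter_unroll (M := fun p => W (p % (t + 1))) (α := α)
    (G := fun p => cen (g (t + 1 + p))) (X := fun p => cen (x (t + 1 + p)))
    (z := fun q => mix (trackSchedule (t + 1) U (t + 1 + q)) (cen (s (t + q + 1) - s (t + q))))
    (by
      have := hcg t
      rw [hg0, zero_add] at this
      exact this)
    (fun p => by
      have := hcg (t + 1 + p)
      -- Within the unrolled range the additional averaging acts only at iteration `t + 1`, that is,
      -- on the input `z 0`.
      have h2 : trackSchedule (t + 1) U (t + 1 + p + 1) = 1 := by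
        simp only [trackSchedule]; rw [if_neg (by omega)]
      have h3 : t + (p + 1) + 1 = t + 1 + p + 1 := by omega
      have h4 : t + (p + 1) = t + 1 + p := by omega
      rw [h2, mix_one, hM] at this
      simp only [← add_assoc, h2, mix_one]
      rw [this]
      congr 4 <;> omega)
    h1 (fun p => by
      have := hcx (t + 1 + p)
      rwa [hM] at this) p
  rw [key]
  congr 1
  refine Finset.sum_congr rfl fun q _ => ?_
  rw [mix_mul]
  unfold lag
  split_ifs with hl
  · rfl
  · rw [← cen_mix (hB _), mix_sweep_cen_eq_zero hn hW q _ (not_lt.1 hl), smul_zero, smul_zero]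

end

end Dynamics

/-! ### Smooth functions -/

section Smooth

/-- Along the segment, `f` minus the quadratic upper bound has nonpositive derivative, by
Cauchy–Schwarz and the Lipschitz bound. -/
lemma le_add_inner_gradient {E : Type*} [NormedAddCommGroup E] [InnerProductSpace ℝ E]
    [CompleteSpace E] {f : E → ℝ} {L : ℝ} (hf : Differentiable ℝ f)
    (hL : ∀ x y, ‖gradient f x - gradient f y‖ ≤ L * ‖x - y‖) (x v : E) :
    f (x + v) ≤ f x + inner ℝ (gradient f x) v + L / 2 * ‖v‖ ^ 2 := by
  have hd : ∀ t : ℝ, HasDerivAt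
      (fun t : ℝ => f (x + t • v) - t * inner ℝ (gradient f x) v - t ^ 2 * (L / 2 * ‖v‖ ^ 2))
      (inner ℝ (gradient f (x + t • v)) v - inner ℝ (gradient f x) v
        - 2 * t * (L / 2 * ‖v‖ ^ 2)) t := by
    intro t
    have h1 : HasDerivAt (fun t : ℝ => x + t • v) v t := by
      simpa using ((hasDerivAt_id t).smul_const v).const_add x
    have h2 := (hf (x + t • v)).hasFDerivAt.comp_hasDerivAt t h1
    rw [← inner_gradient_left] at h2
    have h3 := (hasDerivAt_id t).mul_const (inner ℝ (gradient f x) v)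
    have h4 := (hasDerivAt_pow 2 t).mul_const (L / 2 * ‖v‖ ^ 2)
    exact ((h2.sub h3).sub h4).congr_deriv (by simp)
  have hanti := antitoneOn_of_deriv_nonpos (convex_Icc (0 : ℝ) 1)
    (fun t _ => (hd t).continuousAt.continuousWithinAt)
    (fun t _ => (hd t).differentiableAt.differentiableWithinAt)
    (fun t ht => by
      rw [interior_Icc] at ht
      rw [(hd t).deriv, ← inner_sub_left]
      have h1 := real_inner_le_norm (gradient f (x + t • v) - gradient f x) v
      have h2 := hL (x + t • v) x
      rw [add_sub_cancel_left, norm_smul, Real.norm_of_nonneg ht.1.le] at h2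
      nlinarith [norm_nonneg v])
  have := hanti (Set.left_mem_Icc.2 zero_le_one) (Set.right_mem_Icc.2 zero_le_one) zero_le_one
  simp only [one_smul, zero_smul, one_mul, one_pow, add_zero] at this
  linarith

/-- A gradient step of length `L⁻¹` cannot go below `m`. This turns integrability of the initial
objective value into square integrability of the initial gradient. -/
lemma norm_gradient_sq_le {E : Type*} [NormedAddCommGroup E] [InnerProductSpace ℝ E]
    [CompleteSpace E] {f : E → ℝ} {L : ℝ} (hf : Differentiable ℝ f) (hpos : 0 < L)
    (hL : ∀ x y, ‖gradient f x - gradient f y‖ ≤ L * ‖x - y‖) {m : ℝ} (hm : ∀ x, m ≤ f x)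
    (x : E) : ‖gradient f x‖ ^ 2 ≤ 2 * L * (f x - m) := by
  have h := (hm _).trans (le_add_inner_gradient hf hL x (-(L⁻¹ • gradient f x)))
  rw [inner_neg_right, real_inner_smul_right, real_inner_self_eq_norm_sq, norm_neg, norm_smul,
    Real.norm_of_nonneg (by positivity)] at h
  have h2 : L / 2 * (L⁻¹ * ‖gradient f x‖) ^ 2 = 1 / 2 * (L⁻¹ * ‖gradient f x‖ ^ 2) := by
    field_simp
  have h3 : ‖gradient f x‖ ^ 2 = L * (L⁻¹ * ‖gradient f x‖ ^ 2) := by field_simp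
  rw [h3]
  nlinarith

variable {n d : ℕ} {Ξ : Fin n → Type*} [∀ i, MeasurableSpace (Ξ i)]
  {P : ∀ i, Measure (Ξ i)} {F : ∀ i, Vec d → Ξ i → ℝ} {L : ℝ}

lemma SmoothProblem.differentiable_localObj (h : SmoothProblem P F L) (i : Fin n) :
    Differentiable ℝ (localObj P F i) :=
  (h.contDiff i).differentiable one_ne_zero

lemma SmoothProblem.hasFDerivAt_obj (h : SmoothProblem P F L) (x : Vec d) :
    HasFDerivAt (obj P F) ((n : ℝ)⁻¹ • ∑ i, fderiv ℝ (localObj P F i) x) x := by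
  have := (HasFDerivAt.fun_sum (u := Finset.univ) fun i _ =>
    (h.differentiable_localObj i x).hasFDerivAt).const_mul (n : ℝ)⁻¹
  exact this

lemma SmoothProblem.differentiable_obj (h : SmoothProblem P F L) :
    Differentiable ℝ (obj P F) := fun x => (h.hasFDerivAt_obj x).differentiableAt

lemma SmoothProblem.gradient_obj (h : SmoothProblem P F L) (x : Vec d) :
    gradient (obj P F) x = avg (trueGrad P F fun _ => x) := by
  simp [gradient, (h.hasFDerivAt_obj x).fderiv, avg, trueGrad]

lemma SmoothProblem.nsq_trueGrad_sub_le (h : SmoothProblem P F L) (x y : Fin n → Vec d) :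
    nsq (trueGrad P F x - trueGrad P F y) ≤ L ^ 2 * nsq (x - y) := by
  simp only [nsq, Finset.mul_sum]
  refine Finset.sum_le_sum fun i _ => ?_
  rw [← mul_pow]
  exact pow_le_pow_left₀ (norm_nonneg _) (h.lipschitz i _ _) 2

lemma SmoothProblem.norm_avg_trueGrad_sub_sq_le (h : SmoothProblem P F L) (x : Fin n → Vec d) :
    ‖avg (trueGrad P F x) - gradient (obj P F) (avg x)‖ ^ 2
      ≤ (n : ℝ)⁻¹ * (L ^ 2 * nsq (cen x)) := by
  rw [h.gradient_obj, ← avg_sub]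
  refine (norm_avg_sq_le _).trans ?_
  gcongr
  exact h.nsq_trueGrad_sub_le _ _

lemma SmoothProblem.lipschitz_obj (h : SmoothProblem P F L) (x y : Vec d) :
    ‖gradient (obj P F) x - gradient (obj P F) y‖ ≤ L * ‖x - y‖ := by
  have hL := h.pos
  rw [h.gradient_obj, h.gradient_obj, ← avg_sub]
  refine le_of_sq_le_sq ?_ (by positivity)
  refine (norm_avg_sq_le _).trans ?_
  refine (mul_le_mul_of_nonneg_left (h.nsq_trueGrad_sub_le _ _) (by positivity)).trans ?_
  rcases Nat.eq_zero_or_pos n with rfl | hn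
  · simp; positivity
  · have : (n : ℝ) ≠ 0 := by positivity
    simp [nsq]
    field_simp
    exact le_refl _

lemma SmoothProblem.optVal_le (h : SmoothProblem P F L) (x : Vec d) :
    optVal P F ≤ obj P F x := ciInf_le h.bddBelow x

lemma SmoothProblem.continuous_gradient_localObj (h : SmoothProblem P F L) (i : Fin n) :
    Continuous (gradient (localObj P F i)) := by
  have : Continuous (fderiv ℝ (localObj P F i)) := (h.contDiff i).continuous_fderiv one_ne_zero
  exact (InnerProductSpace.toDual ℝ (Vec d)).symm.continuous.comp this

lemma SmoothProblem.continuous_gradient_obj (h : SmoothProblem P F L) :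
    Continuous (gradient (obj P F)) := by
  have : gradient (obj P F) = fun x => (n : ℝ)⁻¹ • ∑ i, gradient (localObj P F i) x :=
    funext fun x => h.gradient_obj x
  rw [this]
  exact Continuous.const_smul (continuous_finsetSum _ fun i _ => h.continuous_gradient_localObj i)
    (n : ℝ)⁻¹

/-- One step of the averaged iterates decreases the objective, up to the error `e` of the
averaged gradients. -/
lemma SmoothProblem.obj_step_le (h : SmoothProblem P F L) {α : ℝ} (hα : 0 ≤ α)
    (x : Fin n → Vec d) (e : Vec d) :
    obj P F (avg x - α • (avg (trueGrad P F x) + e)) ≤ obj P F (avg x)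
      - α / 2 * ‖gradient (obj P F) (avg x)‖ ^ 2
      - α / 2 * (1 - L * α) * ‖avg (trueGrad P F x)‖ ^ 2
      + α * L ^ 2 / (2 * n) * nsq (cen x) + L * α ^ 2 / 2 * ‖e‖ ^ 2
      - α * inner ℝ (gradient (obj P F) (avg x)) e
      + L * α ^ 2 * inner ℝ (avg (trueGrad P F x)) e := by
  have h1 := le_add_inner_gradient h.differentiable_obj h.lipschitz_obj (avg x)
    (-(α • (avg (trueGrad P F x) + e)))
  have h2 := h.norm_avg_trueGrad_sub_sq_le x
  rw [← sub_eq_add_neg, norm_neg, norm_smul, inner_neg_right, real_inner_smul_right,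
    inner_add_right, mul_pow, Real.norm_eq_abs, sq_abs, norm_add_sq_real] at h1
  rw [norm_sub_sq_real, real_inner_comm] at h2
  have h3 : α * L ^ 2 / (2 * n) * nsq (cen x) = α / 2 * ((n : ℝ)⁻¹ * (L ^ 2 * nsq (cen x))) := by
    ring
  have h4 := mul_le_mul_of_nonneg_left h2 (by positivity : 0 ≤ α / 2)
  rw [h3]
  linarith

end Smooth

/-! ### Independence and conditional centering -/

section Indep

/-- The intersections `s ∩ t` form a π-system generating `m₀ ⊔ m₁`, and on these the measure
factorizes in two stages. -/
lemma indep_sup_of_indep {Ω : Type*} {mΩ : MeasurableSpace Ω} {μ : Measure Ω}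
    [IsProbabilityMeasure μ] {m₀ m₁ m₂ : MeasurableSpace Ω} (h₀ : m₀ ≤ mΩ) (h₁ : m₁ ≤ mΩ)
    (h₂ : m₂ ≤ mΩ) (h : Indep m₀ (m₁ ⊔ m₂) μ) (h' : Indep m₁ m₂ μ) :
    Indep (m₀ ⊔ m₁) m₂ μ := by
  rw [Indep_iff] at h h'
  refine IndepSets.indep (p1 := {u | ∃ s t, MeasurableSet[m₀] s ∧ MeasurableSet[m₁] t ∧ s ∩ t = u})
    (p2 := {u | MeasurableSet[m₂] u}) (sup_le h₀ h₁) h₂ ?_ ?_ ?_ ?_ ?_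
  · rintro _ ⟨s, t, hs, ht, rfl⟩ _ ⟨s', t', hs', ht', rfl⟩ -
    exact ⟨s ∩ s', t ∩ t', hs.inter hs', ht.inter ht', Set.inter_inter_inter_comm _ _ _ _⟩
  · exact @MeasurableSpace.isPiSystem_measurableSet _ m₂
  · refine le_antisymm (sup_le ?_ ?_) (MeasurableSpace.generateFrom_le ?_)
    · exact fun s hs => MeasurableSpace.measurableSet_generateFrom
        ⟨s, Set.univ, hs, MeasurableSet.univ, Set.inter_univ s⟩
    · exact fun t ht => MeasurableSpace.measurableSet_generateFrom
        ⟨Set.univ, t, MeasurableSet.univ, ht, Set.univ_inter t⟩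
    · rintro _ ⟨s, t, hs, ht, rfl⟩
      exact MeasurableSet.inter ((le_sup_left : m₀ ≤ m₀ ⊔ m₁) s hs)
        ((le_sup_right : m₁ ≤ m₀ ⊔ m₁) t ht)
  · exact (@MeasurableSpace.generateFrom_measurableSet _ m₂).symm
  · rw [IndepSets_iff]
    rintro _ u ⟨s, t, hs, ht, rfl⟩ hu
    have ht' : MeasurableSet[m₁ ⊔ m₂] t := (le_sup_left : m₁ ≤ m₁ ⊔ m₂) t ht
    have hu' : MeasurableSet[m₁ ⊔ m₂] u := (le_sup_right : m₂ ≤ m₁ ⊔ m₂) u hu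
    rw [Set.inter_assoc, h s (t ∩ u) hs (ht'.inter hu'), h' t u ht hu, h s t hs ht', mul_assoc]

lemma integrable_inner_of_memLp {Ω E : Type*} {mΩ : MeasurableSpace Ω} {μ : Measure Ω}
    [NormedAddCommGroup E] [InnerProductSpace ℝ E] {Y Z : Ω → E} (hY : MemLp Y 2 μ)
    (hZ : MemLp Z 2 μ) : Integrable (fun ω => (inner ℝ (Y ω) (Z ω) : ℝ)) μ :=
  (hY.norm.integrable_mul hZ.norm).mono' (hY.1.inner hZ.1)
    (ae_of_all _ fun _ => norm_inner_le_norm _ _)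

/-- A square-integrable function of `X` and of an independent sample which is centered given a
`σ`-algebra containing that of `X` is orthogonal to everything that is independent of the sample
jointly with `X`. -/
lemma integral_inner_eq_zero_of_indepFun {Ω 𝒳 Ξ E : Type*} {m mΩ : MeasurableSpace Ω}
    {μ : Measure Ω} [IsProbabilityMeasure μ] [MeasurableSpace 𝒳] [MeasurableSpace Ξ]
    [NormedAddCommGroup E] [InnerProductSpace ℝ E] [CompleteSpace E] [MeasurableSpace E]
    [BorelSpace E] [SecondCountableTopology E]
    (hm : m ≤ mΩ) {Z : Ω → E} {X : Ω → 𝒳} {ξ : Ω → Ξ} {φ : 𝒳 × Ξ → E}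
    (hZ : Measurable Z) (hX : Measurable[m] X) (hξ : Measurable ξ) (hφ : Measurable φ)
    (hind : IndepFun (fun ω => (Z ω, X ω)) ξ μ) (hZ2 : MemLp Z 2 μ)
    (hφ2 : MemLp (fun ω => φ (X ω, ξ ω)) 2 μ) (hc : μ[fun ω => φ (X ω, ξ ω) | m] =ᵐ[μ] 0) :
    ∫ ω, inner ℝ (Z ω) (φ (X ω, ξ ω)) ∂μ = 0 := by
  have hX' : Measurable X := hX.mono hm le_rfl
  have hint : Integrable (fun ω => φ (X ω, ξ ω)) μ := hφ2.integrable (by norm_num)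
  have : IsProbabilityMeasure (μ.map ξ) := Measure.isProbabilityMeasure_map hξ.aemeasurable
  have : IsProbabilityMeasure (μ.map X) := Measure.isProbabilityMeasure_map hX'.aemeasurable
  have : IsProbabilityMeasure (μ.map fun ω => (Z ω, X ω)) :=
    Measure.isProbabilityMeasure_map (hZ.prodMk hX').aemeasurable
  have hmapX : μ.map (fun ω => (X ω, ξ ω)) = (μ.map X).prod (μ.map ξ) :=
    (indepFun_iff_map_prod_eq_prod_map_map hX'.aemeasurable hξ.aemeasurable).1
      (hind.comp measurable_snd measurable_id)
  have hmapZ := (indepFun_iff_map_prod_eq_prod_map_map (hZ.prodMk hX').aemeasurable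
    hξ.aemeasurable).1 hind
  have hφm : StronglyMeasurable φ := hφ.stronglyMeasurable
  have hintφ : Integrable φ ((μ.map X).prod (μ.map ξ)) := by
    rw [← hmapX]
    exact (integrable_map_measure hφm.aestronglyMeasurable
      (hX'.prodMk hξ).aemeasurable).2 hint
  -- Conditional centering becomes centering in the sample for almost every frozen state: the
  -- integral over `s` is that of the conditional expectation over `X ⁻¹' s`, a set of `m`. Fubini
  -- over the joint law of `(Z, X)` then concludes.
  have hh : (fun y => ∫ ζ, φ (y, ζ) ∂(μ.map ξ)) =ᵐ[μ.map X] 0 := by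
    refine ae_eq_zero_of_forall_setIntegral_eq_of_sigmaFinite
      (fun s _ _ => hintφ.integral_prod_left.integrableOn) fun s hs _ => ?_
    have h1 : ∫ p in s ×ˢ Set.univ, φ p ∂((μ.map X).prod (μ.map ξ))
        = ∫ y in s, ∫ ζ, φ (y, ζ) ∂(μ.map ξ) ∂(μ.map X) := by
      rw [setIntegral_prod _ hintφ.integrableOn, Measure.restrict_univ]
    rw [← h1, ← hmapX, setIntegral_map (hs.prod MeasurableSet.univ) hφm.aestronglyMeasurable
      (hX'.prodMk hξ).aemeasurable]
    have h2 : (fun ω => (X ω, ξ ω)) ⁻¹' s ×ˢ Set.univ = X ⁻¹' s := by ext; simp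
    rw [h2, ← setIntegral_condExp hm hint (hX hs),
      setIntegral_congr_ae (g := fun _ => 0) (hX' hs) (hc.mono fun ω hω _ => hω)]
    simp
  have hψ : Measurable fun p : (E × 𝒳) × Ξ => (inner ℝ p.1.1 (φ (p.1.2, p.2)) : ℝ) :=
    measurable_fst.fst.inner (hφ.comp (measurable_fst.snd.prodMk measurable_snd))
  have hinner : Integrable (fun ω => (inner ℝ (Z ω) (φ (X ω, ξ ω)) : ℝ)) μ := 
    integrable_inner_of_memLp hZ2 hφ2
  have hintψ : Integrable (fun p : (E × 𝒳) × Ξ => (inner ℝ p.1.1 (φ (p.1.2, p.2)) : ℝ))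
      ((μ.map fun ω => (Z ω, X ω)).prod (μ.map ξ)) := by
    rw [← hmapZ]
    exact (integrable_map_measure hψ.aestronglyMeasurable
      ((hZ.prodMk hX').prodMk hξ).aemeasurable).2 hinner
  have hmap : (μ.map fun ω => (Z ω, X ω)).map Prod.snd = μ.map X := by
    rw [Measure.map_map measurable_snd (hZ.prodMk hX')]; rfl
  have e1 := hintφ.prod_right_ae
  rw [← hmap] at e1 hh
  have e1' := ae_of_ae_map measurable_snd.aemeasurable e1
  have hh' := ae_of_ae_map measurable_snd.aemeasurable hh
  calc ∫ ω, inner ℝ (Z ω) (φ (X ω, ξ ω)) ∂μ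
      = ∫ p, inner ℝ p.1.1 (φ (p.1.2, p.2)) ∂((μ.map fun ω => (Z ω, X ω)).prod (μ.map ξ)) := by
        rw [← hmapZ, integral_map ((hZ.prodMk hX').prodMk hξ).aemeasurable
          hψ.aestronglyMeasurable]
    _ = ∫ p, ∫ ζ, inner ℝ p.1 (φ (p.2, ζ)) ∂(μ.map ξ) ∂(μ.map fun ω => (Z ω, X ω)) :=
        integral_prod _ hintψ
    _ = ∫ _, (0 : ℝ) ∂(μ.map fun ω => (Z ω, X ω)) := by
        refine integral_congr_ae ?_
        filter_upwards [e1', hh'] with p hp hp'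
        rw [integral_inner hp, hp', Pi.zero_apply, inner_zero_right]
    _ = 0 := by simp

/-- The partial derivatives are pointwise limits of difference quotients with increment `1 / k`,
which are jointly measurable. -/
lemma measurable_gradient_param {d : ℕ} {Ξ : Type*} [MeasurableSpace Ξ] {F : Vec d → Ξ → ℝ}
    (hF : Measurable fun p : Vec d × Ξ => F p.1 p.2) (hd : ∀ ζ, Differentiable ℝ fun x => F x ζ) :
    Measurable fun p : Vec d × Ξ => gradient (fun y => F y p.2) p.1 := by
  have h : ∀ i, Measurable fun p : Vec d × Ξ =>
      fderiv ℝ (fun y => F y p.2) p.1 (EuclideanSpace.single i 1) := by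
    intro i
    refine measurable_of_tendsto_metrizable (f := fun (k : ℕ) (p : Vec d × Ξ) =>
      (k : ℝ) • (F (p.1 + (k : ℝ)⁻¹ • EuclideanSpace.single i 1) p.2 - F p.1 p.2)) ?_ ?_
    · intro k
      refine Measurable.const_smul (Measurable.sub ?_ hF) (k : ℝ)
      exact hF.comp ((measurable_fst.add_const _).prodMk measurable_snd)
    · refine tendsto_pi_nhds.2 fun p => ?_
      refine ((hd p.2 p.1).hasFDerivAt.lim_real _).comp tendsto_natCast_atTop_atTop
  have h2 : (fun p : Vec d × Ξ => gradient (fun y => F y p.2) p.1) = fun p =>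
      WithLp.toLp 2 fun i => fderiv ℝ (fun y => F y p.2) p.1 (EuclideanSpace.single i 1) := by
    ext p i
    simp [← inner_gradient_left, EuclideanSpace.inner_single_right]
  rw [h2]
  exact (WithLp.measurable_toLp 2 (Fin d → ℝ)).comp (measurable_pi_lambda _ h)

end Indep

/-! ### Measurability and orthogonality of the gradient noise. -/

section Noise

variable {n d : ℕ} {Ξ : Fin n → Type*} [∀ i, MeasurableSpace (Ξ i)]
  {P : ∀ i, Measure (Ξ i)} {F : ∀ i, Vec d → Ξ i → ℝ} {L σ : ℝ}

lemma measurable_mix (A : Matrix (Fin n) (Fin n) ℝ) :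
    Measurable (mix A : (Fin n → Vec d) → Fin n → Vec d) :=
  measurable_pi_lambda _ fun i =>
    Finset.measurable_sum _ fun j _ => (measurable_pi_apply j).const_smul (A i j)

lemma measurable_avg : Measurable (avg : (Fin n → Vec d) → Vec d) :=
  (Finset.measurable_sum _ fun j _ => measurable_pi_apply j).const_smul (n : ℝ)⁻¹

lemma measurable_stochGrad (hF : LossRegular P F) {Ω : Type*} [MeasurableSpace Ω]
    {x : Ω → Fin n → Vec d} {ζ : ∀ i, Ω → Ξ i} (hx : Measurable x) (hζ : ∀ i, Measurable (ζ i)) :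
    Measurable fun ω => stochGrad F (x ω) fun i => ζ i ω :=
  measurable_pi_lambda _ fun i =>
    (measurable_gradient_param (hF.measurable i) (hF.differentiable i)).comp
      (((measurable_pi_apply i).comp hx).prodMk (hζ i))

lemma measurable_gradTracking (hF : LossRegular P F) {Ω : Type*} [MeasurableSpace Ω]
    {x₀ : Ω → Fin n → Vec d} {ξ : ℕ → ∀ i, Ω → Ξ i} (A B : ℕ → Matrix (Fin n) (Fin n) ℝ) (α : ℝ)
    (hx : Measurable x₀) (k : ℕ) :
    ((∀ l < k, ∀ i, Measurable (ξ l i)) →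
      Measurable fun ω => (gradTracking F A B α (x₀ ω) (fun j i => ξ j i ω) k).1) ∧
    ((∀ l < k + 1, ∀ i, Measurable (ξ l i)) →
      Measurable fun ω => (gradTracking F A B α (x₀ ω) (fun j i => ξ j i ω) k).2) := by
  induction k with
  | zero =>
    refine ⟨fun _ => hx, fun h => ?_⟩
    exact (measurable_mix _).comp (measurable_stochGrad hF hx (h 0 (by omega)))
  | succ k ih =>
    have h1 : (∀ l < k + 1, ∀ i, Measurable (ξ l i)) →
        Measurable fun ω => (gradTracking F A B α (x₀ ω) (fun j i => ξ j i ω) (k + 1)).1 := by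
      intro h
      exact (measurable_mix _).comp
        ((ih.1 fun l hl => h l (by omega)).sub ((ih.2 h).const_smul α))
    refine ⟨h1, fun h => ?_⟩
    have h' : ∀ l < k + 1, ∀ i, Measurable (ξ l i) := fun l hl => h l (by omega)
    exact (measurable_mix _).comp ((((measurable_mix _).comp (ih.2 h')).add
      (measurable_stochGrad hF (h1 h') (h (k + 1) (by omega)))).sub
      (measurable_stochGrad hF (ih.1 fun l hl => h l (by omega)) (h k (by omega))))

variable {Ω : Type*} {mΩ : MeasurableSpace Ω} {μ : Measure Ω}
  {W V U : ℕ → Matrix (Fin n) (Fin n) ℝ} {τ : ℕ} {α : ℝ}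
  {x₀ : Ω → Fin n → Vec d} {ξ : ℕ → ∀ i, Ω → Ξ i}

/-- Everything but the sample `q`: the initial condition and all the other samples. -/
@[reducible] def others (x₀ : Ω → Fin n → Vec d) (ξ : ℕ → ∀ i, Ω → Ξ i) (q : ℕ × Fin n) : MeasurableSpace Ω :=
  MeasurableSpace.comap x₀ inferInstance ⊔
    ⨆ p ∈ ({q}ᶜ : Set (ℕ × Fin n)), MeasurableSpace.comap (ξ p.1 p.2) inferInstance

lemma measurable_others_sample {p q : ℕ × Fin n} (hpq : p ≠ q) :
    Measurable[others x₀ ξ q] (ξ p.1 p.2) := by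
  have h1 : MeasurableSpace.comap (ξ p.1 p.2) inferInstance ≤ others x₀ ξ q :=
    (le_iSup₂_of_le (f := fun (p : ℕ × Fin n) (_ : p ∈ ({q}ᶜ : Set (ℕ × Fin n))) =>
      MeasurableSpace.comap (ξ p.1 p.2) inferInstance) p hpq le_rfl).trans le_sup_right
  exact (comap_measurable _).mono h1 le_rfl


lemma others_le (hx₀ : Measurable x₀) (hξ : ∀ k i, Measurable (ξ k i)) (q : ℕ × Fin n) :
    others x₀ ξ q ≤ mΩ :=
  sup_le hx₀.comap_le (iSup₂_le fun p _ => (hξ p.1 p.2).comap_le)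

lemma indep_others [IsProbabilityMeasure μ] (hx₀ : Measurable x₀)
    (hξ : ∀ k i, Measurable (ξ k i)) (hind : iIndepFun (fun p : ℕ × Fin n => ξ p.1 p.2) μ)
    (hind₀ : IndepFun x₀ (fun ω (p : ℕ × Fin n) => ξ p.1 p.2 ω) μ) (q : ℕ × Fin n) :
    Indep (others x₀ ξ q) (MeasurableSpace.comap (ξ q.1 q.2) inferInstance) μ := by
  have hle : ∀ p : ℕ × Fin n, MeasurableSpace.comap (ξ p.1 p.2) inferInstance ≤
      MeasurableSpace.comap (fun ω (p : ℕ × Fin n) => ξ p.1 p.2 ω) inferInstance := fun p =>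
    measurable_iff_comap_le.1 ((measurable_pi_apply (X := fun p : ℕ × Fin n => Ξ p.2) p).comp
      (comap_measurable fun ω (p : ℕ × Fin n) => ξ p.1 p.2 ω))
  refine indep_sup_of_indep hx₀.comap_le (iSup₂_le fun p _ => (hξ p.1 p.2).comap_le)
    (hξ _ _).comap_le ?_ ?_
  · refine indep_of_indep_of_le_right ((IndepFun_iff_Indep _ _ _).1 hind₀) ?_
    exact sup_le (iSup₂_le fun p _ => hle p) (hle q)
  · have := indep_iSup_of_disjoint (fun p : ℕ × Fin n => (hξ p.1 p.2).comap_le)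
      ((iIndepFun_iff_iIndep _ _ _).1 hind) (S := {q}ᶜ) (T := {q}) disjoint_compl_left
    simpa using this

lemma history_le {x : ℕ → Ω → Fin n → Vec d} (hx : ∀ k, Measurable (x k)) (k : ℕ) :
    history x k ≤ mΩ := iSup₂_le fun j _ => (hx j).comap_le

lemma measurable_history (x : ℕ → Ω → Fin n → Vec d) (k : ℕ) :
    Measurable[history x k] (x k) := by
  have h1 : MeasurableSpace.comap (x k) inferInstance ≤ history x k :=
    le_iSup₂_of_le (f := fun (j : ℕ) (_ : j ∈ Finset.range (k + 1)) =>
      MeasurableSpace.comap (x j) inferInstance) k (Finset.self_mem_range_succ k) le_rfl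
  exact (comap_measurable _).mono h1 le_rfl

/-- The gradient noise of agent `i` as a function of the parameters and the sample. -/
noncomputable def noiseFun (P : ∀ i, Measure (Ξ i)) (F : ∀ i, Vec d → Ξ i → ℝ) (i : Fin n)
    (p : (Fin n → Vec d) × Ξ i) : Vec d :=
  gradient (fun y => F i y p.2) (p.1 i) - gradient (localObj P F i) (p.1 i)

lemma measurable_noiseFun (hF : LossRegular P F) (hS : SmoothProblem P F L) (i : Fin n) :
    Measurable (noiseFun P F i) := by
  have h1 : Measurable fun p : (Fin n → Vec d) × Ξ i => p.1 i :=
    (measurable_pi_apply i).comp measurable_fst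
  exact ((measurable_gradient_param (hF.measurable i) (hF.differentiable i)).comp
    (h1.prodMk measurable_snd)).sub ((hS.continuous_gradient_localObj i).measurable.comp h1)

lemma measurable_iterates (hF : LossRegular P F) (hx₀ : Measurable x₀)
    (hξ : ∀ k i, Measurable (ξ k i)) (k : ℕ) :
    Measurable (iterates F τ W V U α x₀ ξ k) :=
  (measurable_gradTracking hF _ _ _ hx₀ k).1 fun l _ i => hξ l i

lemma measurable_others_iterates (hF : LossRegular P F) {k : ℕ} {q : ℕ × Fin n} (hk : k ≤ q.1) :
    Measurable[others x₀ ξ q] (iterates F τ W V U α x₀ ξ k) := by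
  let _ : MeasurableSpace Ω := others x₀ ξ q
  have h0 : MeasurableSpace.comap x₀ inferInstance ≤ others x₀ ξ q := le_sup_left
  refine (measurable_gradTracking hF _ _ _ ((comap_measurable _).mono h0 le_rfl) k).1
    fun l hl i => measurable_others_sample (p := (l, i)) fun h => ?_
  rw [← h] at hk
  exact absurd hk (not_le.2 hl)

lemma measurable_others_noise (hF : LossRegular P F) (hS : SmoothProblem P F L)
    {p q : ℕ × Fin n} (hpq : p ≠ q) (hle : p.1 ≤ q.1) :
    Measurable[others x₀ ξ q] (noise P F (iterates F τ W V U α x₀ ξ) ξ p.1 p.2) :=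
  (measurable_noiseFun hF hS p.2).comp
    ((measurable_others_iterates hF hle).prodMk (measurable_others_sample hpq))

/-- `history` is generated by the iterates alone, and earlier noises need not be measurable for it,
so conditional centering does not suffice for orthogonality. The independence of the sample `q` from
`others` supplies the rest. -/
lemma integral_inner_noise_eq_zero [IsProbabilityMeasure μ] (hF : LossRegular P F)
    (hS : SmoothProblem P F L)
    (hN : NoiseAssumption μ P F (iterates F τ W V U α x₀ ξ) ξ σ) {q : ℕ × Fin n}
    {Z : Ω → Vec d} (hZ : Measurable[others x₀ ξ q] Z) (hZ2 : MemLp Z 2 μ) :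
    ∫ ω, inner ℝ (Z ω) (noise P F (iterates F τ W V U α x₀ ξ) ξ q.1 q.2 ω) ∂μ = 0 := by
  have hx₀ : Measurable x₀ := hN.measurable_init
  have hξ := hN.measurable_sample
  have hx := measurable_iterates (τ := τ) (W := W) (V := V) (U := U) (α := α) hF hx₀ hξ
  have hind := indep_others hx₀ hξ hN.indep hN.indep_init q
  refine integral_inner_eq_zero_of_indepFun (history_le hx q.1) (φ := noiseFun P F q.2)
    (hZ.mono (others_le hx₀ hξ q) le_rfl) (measurable_history _ q.1) (hξ q.1 q.2)
    (measurable_noiseFun hF hS q.2) ?_ hZ2 (hN.memLp q.1 q.2) (hN.unbiased q.1 q.2)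
  rw [IndepFun_iff_Indep]
  refine indep_of_indep_of_le_left hind (Measurable.comap_le ?_)
  exact hZ.prodMk (measurable_others_iterates hF le_rfl)

/-- The noise with the larger time index plays the centered role; at equal times either one can. -/
lemma noise_orthogonal [IsProbabilityMeasure μ] (hF : LossRegular P F)
    (hS : SmoothProblem P F L)
    (hN : NoiseAssumption μ P F (iterates F τ W V U α x₀ ξ) ξ σ) {p q : ℕ × Fin n}
    (hpq : p ≠ q) :
    ∫ ω, (inner ℝ (noise P F (iterates F τ W V U α x₀ ξ) ξ p.1 p.2 ω)
      (noise P F (iterates F τ W V U α x₀ ξ) ξ q.1 q.2 ω) : ℝ) ∂μ = 0 := by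
  rcases le_total p.1 q.1 with h | h
  · exact integral_inner_noise_eq_zero hF hS hN (measurable_others_noise hF hS hpq h)
      (hN.memLp _ _)
  · refine (integral_congr_ae (ae_of_all _ fun ω => real_inner_comm _ _)).trans ?_
    exact integral_inner_noise_eq_zero hF hS hN (measurable_others_noise hF hS hpq.symm h)
      (hN.memLp _ _)

lemma NoiseAssumption.integral_norm_sq_le [IsProbabilityMeasure μ]
    {x : ℕ → Ω → Fin n → Vec d} (hx : ∀ k, Measurable (x k))
    (hN : NoiseAssumption μ P F x ξ σ) (k : ℕ) (i : Fin n) :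
    ∫ ω, ‖noise P F x ξ k i ω‖ ^ 2 ∂μ ≤ σ ^ 2 := by
  rw [← integral_condExp (history_le hx k)]
  refine (integral_mono_ae integrable_condExp (integrable_const _) (hN.variance k i)).trans_eq ?_
  simp

lemma integral_norm_sum_smul_sq_le {ι E : Type*} [NormedAddCommGroup E]
    [InnerProductSpace ℝ E] {N : ι → Ω → E} (hN : ∀ p, MemLp (N p) 2 μ)
    (ho : ∀ p q, p ≠ q → ∫ ω, (inner ℝ (N p ω) (N q ω) : ℝ) ∂μ = 0)
    (hv : ∀ p, ∫ ω, ‖N p ω‖ ^ 2 ∂μ ≤ σ ^ 2) (s : Finset ι) (c : ι → ℝ) :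
    ∫ ω, ‖∑ p ∈ s, c p • N p ω‖ ^ 2 ∂μ ≤ (∑ p ∈ s, c p ^ 2) * σ ^ 2 := by
  classical
  have h1 : ∀ ω, ‖∑ p ∈ s, c p • N p ω‖ ^ 2 =
      ∑ p ∈ s, ∑ q ∈ s, c p * c q * inner ℝ (N p ω) (N q ω) := by
    intro ω
    rw [← real_inner_self_eq_norm_sq, sum_inner]
    refine Finset.sum_congr rfl fun p _ => ?_
    rw [inner_sum]
    refine Finset.sum_congr rfl fun q _ => ?_
    rw [real_inner_smul_left, real_inner_smul_right, mul_assoc]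
  have hi : ∀ p q, Integrable (fun ω => c p * c q * (inner ℝ (N p ω) (N q ω) : ℝ)) μ :=
    fun p q => (integrable_inner_of_memLp (hN p) (hN q)).const_mul _
  simp_rw [h1]
  rw [integral_finsetSum _ fun p _ => integrable_finsetSum _ fun q _ => hi p q, Finset.sum_mul]
  refine Finset.sum_le_sum fun p hp => ?_
  rw [integral_finsetSum _ fun q _ => hi p q, Finset.sum_eq_single_of_mem p hp]
  · rw [integral_const_mul]
    simp_rw [real_inner_self_eq_norm_sq]
    nlinarith [hv p, sq_nonneg (c p)]
  · intro q _ hq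
    rw [integral_const_mul, ho p q hq.symm, mul_zero]

end Noise

/-! ### Square-integrable stacked vectors -/

section SqInt

variable {n d : ℕ} {Ω : Type*} {mΩ : MeasurableSpace Ω} {μ : Measure Ω}

/-- All blocks of a random stacked vector are square-integrable. -/
def SqInt (μ : Measure Ω) (v : Ω → Fin n → Vec d) : Prop := ∀ i, MemLp (fun ω => v ω i) 2 μ

lemma SqInt.add {u v : Ω → Fin n → Vec d} (hu : SqInt μ u) (hv : SqInt μ v) :
    SqInt μ fun ω => u ω + v ω := fun i => (hu i).add (hv i)

lemma SqInt.sub {u v : Ω → Fin n → Vec d} (hu : SqInt μ u) (hv : SqInt μ v) :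
    SqInt μ fun ω => u ω - v ω := fun i => (hu i).sub (hv i)

lemma SqInt.const_smul {v : Ω → Fin n → Vec d} (hv : SqInt μ v) (c : ℝ) :
    SqInt μ fun ω => c • v ω := fun i => (hv i).const_smul c

lemma SqInt.mix {v : Ω → Fin n → Vec d} (hv : SqInt μ v) (A : Matrix (Fin n) (Fin n) ℝ) :
    SqInt μ fun ω => mix A (v ω) := fun i =>
  memLp_finsetSum _ fun j _ => (hv j).const_smul (A i j)

lemma SqInt.sum {ι : Type*} (s : Finset ι) {v : ι → Ω → Fin n → Vec d}
    (hv : ∀ q ∈ s, SqInt μ (v q)) : SqInt μ fun ω => ∑ q ∈ s, v q ω := fun i => by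
  simp only [Finset.sum_apply]
  exact memLp_finsetSum _ fun q hq => hv q hq i

lemma SqInt.memLp_avg {v : Ω → Fin n → Vec d} (hv : SqInt μ v) :
    MemLp (fun ω => avg (v ω)) 2 μ :=
  (memLp_finsetSum _ fun j _ => hv j).const_smul (n : ℝ)⁻¹

lemma SqInt.cen {v : Ω → Fin n → Vec d} (hv : SqInt μ v) : SqInt μ fun ω => cen (v ω) :=
  fun i => (hv i).sub hv.memLp_avg

lemma SqInt.congr {u v : Ω → Fin n → Vec d} (hu : SqInt μ u) (h : ∀ᵐ ω ∂μ, u ω = v ω) :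
    SqInt μ v := fun i => (memLp_congr_ae (h.mono fun ω hω => by simp only [hω])).1 (hu i)

lemma SqInt.integrable_nsq {v : Ω → Fin n → Vec d} (hv : SqInt μ v) :
    Integrable (fun ω => nsq (v ω)) μ :=
  integrable_finsetSum _ fun i _ => (hv i).integrable_norm_pow (by norm_num)

lemma sqInt_zero : SqInt μ fun _ => (0 : Fin n → Vec d) := fun _ => MemLp.zero

end SqInt

/-! ### Runs of gradient tracking with consensual warm-up -/

section Run

variable {n d : ℕ} {Ξ : Fin n → Type*} [∀ i, MeasurableSpace (Ξ i)]
  {Ω : Type*} {mΩ : MeasurableSpace Ω}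

/-- The properties of the iterates `x` and the gradient noise `N` that are used in the convergence
analysis.  The warm-up period has length `t + 1`. -/
structure TrackedRun (μ : Measure Ω) (P : ∀ i, Measure (Ξ i)) (F : ∀ i, Vec d → Ξ i → ℝ)
    (x N : ℕ → Ω → Fin n → Vec d) (M : ℕ → ℕ → Matrix (Fin n) (Fin n) ℝ) (α σ : ℝ) (t : ℕ) :
    Prop where
  measurable : ∀ k, Measurable (x k)
  sqInt_noise : ∀ k, SqInt μ (N k)
  orthogonal : ∀ p q : ℕ × Fin n, p ≠ q →
    ∫ ω, (inner ℝ (N p.1 ω p.2) (N q.1 ω q.2) : ℝ) ∂μ = 0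
  variance : ∀ k i, ∫ ω, ‖N k ω i‖ ^ 2 ∂μ ≤ σ ^ 2
  orthogonal_state : ∀ k i (ψ : (Fin n → Vec d) → Vec d), Measurable ψ →
    MemLp (fun ω => ψ (x k ω)) 2 μ → ∫ ω, (inner ℝ (ψ (x k ω)) (N k ω i) : ℝ) ∂μ = 0
  mem : ∀ p q, M p q ∈ doublyStochastic ℝ (Fin n)
  step : ∀ k ω, avg (x (k + 1) ω) =
    avg (x k ω) - α • (avg (trueGrad P F (x k ω)) + avg (N k ω))
  warm : ∀ᵐ ω ∂μ, ∀ k ≤ t + 1, cen (x k ω) = 0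
  dev : ∀ᵐ ω ∂μ, ∀ p, cen (x (t + 1 + p) ω) = -α • cen (∑ q ∈ Finset.range p,
    lag (t + 1) (p - q) • mix (M p q) ((trueGrad P F (x (t + q + 1) ω)
      - trueGrad P F (x (t + q) ω)) + (N (t + q + 1) ω - N (t + q) ω)))

variable {μ : Measure Ω} {P : ∀ i, Measure (Ξ i)} {F : ∀ i, Vec d → Ξ i → ℝ} {L : ℝ}
  {x N : ℕ → Ω → Fin n → Vec d} {M : ℕ → ℕ → Matrix (Fin n) (Fin n) ℝ} {α σ : ℝ} {t : ℕ}

lemma SmoothProblem.measurable_trueGrad (hS : SmoothProblem P F L) :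
    Measurable (trueGrad P F) :=
  measurable_pi_lambda _ fun i =>
    (hS.continuous_gradient_localObj i).measurable.comp (measurable_pi_apply i)

lemma SmoothProblem.sqInt_trueGrad_sub (hS : SmoothProblem P F L) {u v : Ω → Fin n → Vec d}
    (hu : Measurable u) (hv : Measurable v) (h : SqInt μ fun ω => u ω - v ω) :
    SqInt μ fun ω => trueGrad P F (u ω) - trueGrad P F (v ω) := fun i =>
  (h i).of_le_mul (c := L) (((measurable_pi_apply i).comp
    ((hS.measurable_trueGrad.comp hu).sub (hS.measurable_trueGrad.comp hv))).aestronglyMeasurable)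
    (ae_of_all _ fun _ => hS.lipschitz i _ _)

/-- By the Lipschitz bound, the averaged gradient differs from the gradient at the average by a
quantity dominated by the deviations. -/
lemma SmoothProblem.memLp_avg_trueGrad (hS : SmoothProblem P F L) {u : Ω → Fin n → Vec d}
    (hu : Measurable u) (h : SqInt μ fun ω => cen (u ω))
    (hg : MemLp (fun ω => gradient (obj P F) (avg (u ω))) 2 μ) :
    MemLp (fun ω => avg (trueGrad P F (u ω))) 2 μ := by
  have h1 := (hS.sqInt_trueGrad_sub (v := fun ω _ => avg (u ω)) hu
    (measurable_pi_lambda _ fun _ => measurable_avg.comp hu) h).memLp_avg.add hg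
  refine (memLp_congr_ae (ae_of_all _ fun ω => ?_)).1 h1
  simp only [Pi.add_apply, avg_sub, hS.gradient_obj, sub_add_cancel]

lemma sub_eq_cen_sub_add (u v : Fin n → Vec d) :
    u - v = (cen u - cen v) + fun _ => avg u - avg v := by
  ext1 i; simp only [cen, Pi.sub_apply, Pi.add_apply]; abel

lemma TrackedRun.avg_sub_avg (h : TrackedRun μ P F x N M α σ t) (k : ℕ) (ω : Ω) :
    avg (x (k + 1) ω) - avg (x k ω) = -α • (avg (trueGrad P F (x k ω)) + avg (N k ω)) := by
  rw [h.step, neg_smul]; abel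

lemma TrackedRun.memLp_avg_sub (h : TrackedRun μ P F x N M α σ t) (hS : SmoothProblem P F L)
    {k : ℕ} (hc : SqInt μ fun ω => cen (x k ω))
    (hg : MemLp (fun ω => gradient (obj P F) (avg (x k ω))) 2 μ) :
    MemLp (fun ω => avg (x (k + 1) ω) - avg (x k ω)) 2 μ := by
  simp_rw [h.avg_sub_avg]
  exact ((hS.memLp_avg_trueGrad (h.measurable k) hc hg).add (h.sqInt_noise k).memLp_avg).const_smul
    (-α)

lemma TrackedRun.sqInt_sub_of (h : TrackedRun μ P F x N M α σ t) (hS : SmoothProblem P F L)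
    {k : ℕ} (hc : SqInt μ fun ω => cen (x k ω)) (hc' : SqInt μ fun ω => cen (x (k + 1) ω))
    (hg : MemLp (fun ω => gradient (obj P F) (avg (x k ω))) 2 μ) :
    SqInt μ fun ω => x (k + 1) ω - x k ω := by
  have : (fun ω => x (k + 1) ω - x k ω) = fun ω =>
      (cen (x (k + 1) ω) - cen (x k ω)) + fun _ => avg (x (k + 1) ω) - avg (x k ω) :=
    funext fun ω => sub_eq_cen_sub_add _ _
  rw [this]
  exact (hc'.sub hc).add fun _ => h.memLp_avg_sub hS hc hg

lemma TrackedRun.memLp_gradient_zero [IsProbabilityMeasure μ]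
    (h : TrackedRun μ P F x N M α σ t) (hS : SmoothProblem P F L)
    (h0 : Integrable (fun ω => obj P F (avg (x 0 ω))) μ) :
    MemLp (fun ω => gradient (obj P F) (avg (x 0 ω))) 2 μ := by
  have hm : Measurable fun ω => gradient (obj P F) (avg (x 0 ω)) :=
    hS.continuous_gradient_obj.measurable.comp (measurable_avg.comp (h.measurable 0))
  rw [memLp_two_iff_integrable_sq_norm hm.aestronglyMeasurable]
  refine ((h0.sub (integrable_const (optVal P F))).const_mul (2 * L)).mono'
    (hm.norm.pow_const 2).aestronglyMeasurable (ae_of_all _ fun ω => ?_)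
  rw [Real.norm_of_nonneg (sq_nonneg _)]
  exact norm_gradient_sq_le hS.differentiable_obj hS.pos hS.lipschitz_obj hS.optVal_le _

/-- No second moment of the initial point is assumed, so the iterates themselves may fail to be
square-integrable. Deviations, increments and gradients at the average are, and the induction
carries exactly what propagates. -/
lemma TrackedRun.sqInt_cen_and_memLp_gradient [IsProbabilityMeasure μ]
    (h : TrackedRun μ P F x N M α σ t) (hS : SmoothProblem P F L)
    (h0 : Integrable (fun ω => obj P F (avg (x 0 ω))) μ) (k : ℕ) :
    SqInt μ (fun ω => cen (x k ω)) ∧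
      MemLp (fun ω => gradient (obj P F) (avg (x k ω))) 2 μ := by
  induction k using Nat.strong_induction_on with
  | _ k ih =>
    constructor
    · rcases le_total k (t + 1) with hk | hk
      · exact sqInt_zero.congr (h.warm.mono fun ω hω => (hω k hk).symm)
      · obtain ⟨p, rfl⟩ := Nat.exists_eq_add_of_le hk
        refine SqInt.congr ?_ (h.dev.mono fun ω hω => (hω p).symm)
        refine (SqInt.cen (SqInt.sum _ fun q hq => ((SqInt.add ?_ ?_).mix _).const_smul _)).const_smul
          (-α)
        · have hq' := Finset.mem_range.1 hq
          exact hS.sqInt_trueGrad_sub (h.measurable _) (h.measurable _)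
            (h.sqInt_sub_of hS (ih _ (by omega)).1 (ih _ (by omega)).1 (ih _ (by omega)).2)
        · exact (h.sqInt_noise _).sub (h.sqInt_noise _)
    · rcases k with _ | k
      · exact h.memLp_gradient_zero hS h0
      · have hm : ∀ k, Measurable fun ω => gradient (obj P F) (avg (x k ω)) := fun k =>
          hS.continuous_gradient_obj.measurable.comp (measurable_avg.comp (h.measurable k))
        have h1 : MemLp (fun ω => gradient (obj P F) (avg (x (k + 1) ω))
            - gradient (obj P F) (avg (x k ω))) 2 μ :=
          (h.memLp_avg_sub hS (ih k (by omega)).1 (ih k (by omega)).2).of_le_mul (c := L)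
            ((hm _).sub (hm _)).aestronglyMeasurable
            (ae_of_all _ fun _ => hS.lipschitz_obj _ _)
        refine (memLp_congr_ae (ae_of_all _ fun ω => ?_)).1 (h1.add (ih k (by omega)).2)
        simp

lemma TrackedRun.sqInt_cen [IsProbabilityMeasure μ] (h : TrackedRun μ P F x N M α σ t)
    (hS : SmoothProblem P F L) (h0 : Integrable (fun ω => obj P F (avg (x 0 ω))) μ) (k : ℕ) :
    SqInt μ fun ω => cen (x k ω) :=
  (h.sqInt_cen_and_memLp_gradient hS h0 k).1

lemma TrackedRun.memLp_gradient [IsProbabilityMeasure μ] (h : TrackedRun μ P F x N M α σ t)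
    (hS : SmoothProblem P F L) (h0 : Integrable (fun ω => obj P F (avg (x 0 ω))) μ) (k : ℕ) :
    MemLp (fun ω => gradient (obj P F) (avg (x k ω))) 2 μ :=
  (h.sqInt_cen_and_memLp_gradient hS h0 k).2

lemma TrackedRun.memLp_avg_trueGrad [IsProbabilityMeasure μ]
    (h : TrackedRun μ P F x N M α σ t)
    (hS : SmoothProblem P F L) (h0 : Integrable (fun ω => obj P F (avg (x 0 ω))) μ) (k : ℕ) :
    MemLp (fun ω => avg (trueGrad P F (x k ω))) 2 μ :=
  hS.memLp_avg_trueGrad (h.measurable k) (h.sqInt_cen hS h0 k) (h.memLp_gradient hS h0 k)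

lemma TrackedRun.sqInt_sub [IsProbabilityMeasure μ] (h : TrackedRun μ P F x N M α σ t)
    (hS : SmoothProblem P F L) (h0 : Integrable (fun ω => obj P F (avg (x 0 ω))) μ) (k : ℕ) :
    SqInt μ fun ω => x (k + 1) ω - x k ω :=
  h.sqInt_sub_of hS (h.sqInt_cen hS h0 k) (h.sqInt_cen hS h0 _) (h.memLp_gradient hS h0 k)

/-! ### Second-moment estimates for the noise, the increments and the deviations. -/

lemma TrackedRun.integral_norm_avg_noise_sq_le (h : TrackedRun μ P F x N M α σ t) (hn : 1 ≤ n)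
    (k : ℕ) : ∫ ω, ‖avg (N k ω)‖ ^ 2 ∂μ ≤ σ ^ 2 / n := by
  have hn' : (n : ℝ) ≠ 0 := by positivity
  have := integral_norm_sum_smul_sq_le (N := fun i ω => N k ω i) (h.sqInt_noise k)
    (fun i j hij => h.orthogonal (k, i) (k, j) (by simpa using hij)) (h.variance k)
    Finset.univ fun _ => (n : ℝ)⁻¹
  simp only [← Finset.smul_sum, Finset.sum_const, Finset.card_univ, Fintype.card_fin,
    nsmul_eq_mul] at this
  refine this.trans_eq ?_
  field_simp

lemma TrackedRun.integral_inner_avg_noise (h : TrackedRun μ P F x N M α σ t) (k : ℕ)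
    {ψ : (Fin n → Vec d) → Vec d} (hψ : Measurable ψ) (hψ2 : MemLp (fun ω => ψ (x k ω)) 2 μ) :
    ∫ ω, (inner ℝ (ψ (x k ω)) (avg (N k ω)) : ℝ) ∂μ = 0 := by
  simp only [avg, inner_smul_right, inner_sum]
  rw [integral_const_mul, integral_finsetSum _ fun i _ =>
    integrable_inner_of_memLp hψ2 (h.sqInt_noise k i)]
  simp [h.orthogonal_state k _ ψ hψ hψ2]

lemma TrackedRun.integral_nsq_sum_noise_le (h : TrackedRun μ P F x N M α σ t)
    {A : ℕ → Matrix (Fin n) (Fin n) ℝ} (hA : ∀ q, A q ∈ doublyStochastic ℝ (Fin n))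
    (c : ℕ → ℝ) (p r : ℕ) :
    ∫ ω, nsq (∑ q ∈ Finset.range p, c q • mix (A q) (N (r + q) ω)) ∂μ
      ≤ (∑ q ∈ Finset.range p, c q ^ 2) * (n * σ ^ 2) := by
  have hi : ∀ a, Integrable (fun ω =>
      ‖(∑ q ∈ Finset.range p, c q • mix (A q) (N (r + q) ω)) a‖ ^ 2) μ := fun a =>
    MemLp.integrable_norm_pow (SqInt.sum (Finset.range p) (v := fun q ω =>
      c q • mix (A q) (N (r + q) ω)) (fun q _ =>
        ((h.sqInt_noise (r + q)).mix (A q)).const_smul (c q)) a) (by norm_num)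
  simp only [nsq]
  rw [integral_finsetSum _ fun a _ => hi a]
  have h1 : ∀ a, ∫ ω, ‖(∑ q ∈ Finset.range p, c q • mix (A q) (N (r + q) ω)) a‖ ^ 2 ∂μ
      ≤ (∑ q ∈ Finset.range p, c q ^ 2 * ∑ b, A q a b) * σ ^ 2 := by
    intro a
    have h2 := integral_norm_sum_smul_sq_le (N := fun (z : ℕ × Fin n) ω => N (r + z.1) ω z.2)
      (fun z => h.sqInt_noise _ _)
      (fun z w hzw => h.orthogonal (r + z.1, z.2) (r + w.1, w.2) fun e => hzw (by
        simpa [Prod.ext_iff] using e)) (fun z => h.variance _ _)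
      (Finset.range p ×ˢ Finset.univ) fun z => c z.1 * A z.1 a z.2
    simp only [Finset.sum_product] at h2
    have h3 : ∀ ω, (∑ q ∈ Finset.range p, c q • mix (A q) (N (r + q) ω)) a
        = ∑ q ∈ Finset.range p, ∑ b, (c q * A q a b) • N (r + q) ω b := by
      intro ω
      simp [Finset.sum_apply, mix, Finset.smul_sum, smul_smul]
    simp only [h3]
    refine h2.trans (mul_le_mul_of_nonneg_right ?_ (sq_nonneg σ))
    refine Finset.sum_le_sum fun q _ => ?_
    rw [Finset.mul_sum]
    refine Finset.sum_le_sum fun b _ => ?_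
    rw [mul_pow]
    -- Entries of a doubly stochastic matrix lie in `[0, 1]`, so their squares are bounded by the
    -- entries, whose row sums are one.
    refine mul_le_mul_of_nonneg_left ?_ (sq_nonneg _)
    have h4 := nonneg_of_mem_doublyStochastic (hA q) (i := a) (j := b)
    have h5 := le_one_of_mem_doublyStochastic (hA q) (i := a) (j := b)
    nlinarith
  refine (Finset.sum_le_sum fun a _ => h1 a).trans_eq ?_
  simp only [sum_row_of_mem_doublyStochastic (hA _), mul_one, Finset.sum_const, Finset.card_univ,
    Fintype.card_fin, nsmul_eq_mul]
  ring

/-- Pythagoras splits the increment into deviations and a move of the average. In the latter the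
noise is orthogonal to the gradient, and the factor `n` cancels against the variance `σ ^ 2 / n`. -/
lemma TrackedRun.integral_nsq_sub_le [IsProbabilityMeasure μ]
    (h : TrackedRun μ P F x N M α σ t) (hS : SmoothProblem P F L)
    (h0 : Integrable (fun ω => obj P F (avg (x 0 ω))) μ) (hn : 1 ≤ n) (k : ℕ) :
    ∫ ω, nsq (x (k + 1) ω - x k ω) ∂μ ≤
      2 * ∫ ω, nsq (cen (x (k + 1) ω)) ∂μ + 2 * ∫ ω, nsq (cen (x k ω)) ∂μ
      + n * α ^ 2 * ∫ ω, ‖avg (trueGrad P F (x k ω))‖ ^ 2 ∂μ + α ^ 2 * σ ^ 2 := by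
  have hn' : (n : ℝ) ≠ 0 := by positivity
  have ha := h.memLp_avg_trueGrad hS h0 k
  have he := (h.sqInt_noise k).memLp_avg
  have ia := ha.integrable_norm_pow (by norm_num)
  have ie := he.integrable_norm_pow (by norm_num)
  have iae := integrable_inner_of_memLp ha he
  have ic := (h.sqInt_cen hS h0 k).integrable_nsq
  have ic' := (h.sqInt_cen hS h0 (k + 1)).integrable_nsq
  have hp : ∀ ω, nsq (x (k + 1) ω - x k ω) ≤ 2 * nsq (cen (x (k + 1) ω)) + 2 * nsq (cen (x k ω))
      + n * α ^ 2 * (‖avg (trueGrad P F (x k ω))‖ ^ 2 +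
        2 * inner ℝ (avg (trueGrad P F (x k ω))) (avg (N k ω)) + ‖avg (N k ω)‖ ^ 2) := by
    intro ω
    rw [nsq_eq_cen_add hn, cen_sub, avg_sub, h.avg_sub_avg, norm_smul, mul_pow, norm_add_sq_real,
      Real.norm_eq_abs, sq_abs, neg_sq, ← mul_assoc]
    gcongr
    exact nsq_sub_le _ _
  have i1 := (ic'.const_mul 2).add (ic.const_mul 2)
  have i2 := ia.add (iae.const_mul 2)
  have i3 := (i2.add ie).const_mul (n * α ^ 2)
  have hle := integral_mono (h.sqInt_sub hS h0 k).integrable_nsq (i1.add i3) hp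
  have e1 := integral_add i1 i3
  have e2 := integral_add (ic'.const_mul 2) (ic.const_mul 2)
  have e3 := integral_add i2 ie
  have e4 := integral_add ia (iae.const_mul 2)
  simp only [Pi.add_apply, integral_const_mul] at e1 e2 e3 e4 hle
  rw [e1, e2, e3, e4, h.integral_inner_avg_noise (ψ := fun v => avg (trueGrad P F v)) k
    (measurable_avg.comp hS.measurable_trueGrad) ha] at hle
  have h1 := h.integral_norm_avg_noise_sq_le hn k
  have h2 : (n : ℝ) * α ^ 2 * ∫ ω, ‖avg (N k ω)‖ ^ 2 ∂μ ≤ α ^ 2 * σ ^ 2 := by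
    refine (mul_le_mul_of_nonneg_left h1 (by positivity)).trans_eq ?_
    field_simp
  linarith

lemma TrackedRun.integral_nsq_cen_eq_zero (h : TrackedRun μ P F x N M α σ t) {k : ℕ}
    (hk : k ≤ t + 1) : ∫ ω, nsq (cen (x k ω)) ∂μ = 0 := by
  rw [integral_congr_ae (h.warm.mono fun ω hω => by rw [hω k hk, nsq_zero]), integral_zero]

lemma TrackedRun.integral_nsq_cen_le [IsProbabilityMeasure μ]
    (h : TrackedRun μ P F x N M α σ t) (hS : SmoothProblem P F L)
    (h0 : Integrable (fun ω => obj P F (avg (x 0 ω))) μ) (hn : 1 ≤ n) (p : ℕ) :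
    ∫ ω, nsq (cen (x (t + 1 + p) ω)) ∂μ ≤ α ^ 2 * (4 * ((t + 1 : ℕ) : ℝ) ^ 2 * L ^ 2 *
      ∑ q ∈ Finset.range p, lag (t + 1) (p - q) * ∫ ω, nsq (x (t + q + 1) ω - x (t + q) ω) ∂μ
      + 32 * ((t + 1 : ℕ) : ℝ) ^ 3 * n * σ ^ 2) := by
  -- Successive noise increments share a noise and are not orthogonal. Each of the two shifted sums
  -- `S (t + 1)` and `S t` involves orthogonal noises; each contributes `4 * 4 * τ ^ 3`, whence the
  -- constant 32.
  set S : ℕ → Ω → Fin n → Vec d := fun r ω =>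
    ∑ q ∈ Finset.range p, lag (t + 1) (p - q) • mix (M p q) (N (r + q) ω) with hSdef
  have hSi : ∀ r, Integrable (fun ω => nsq (S r ω)) μ := fun r =>
    (SqInt.sum _ fun q _ => ((h.sqInt_noise (r + q)).mix (M p q)).const_smul _).integrable_nsq
  have hSb : ∀ r, ∫ ω, nsq (S r ω) ∂μ ≤ 4 * ((t + 1 : ℕ) : ℝ) ^ 3 * (n * σ ^ 2) := fun r =>
    (h.integral_nsq_sum_noise_le (h.mem p) (fun q => lag (t + 1) (p - q)) p r).trans
      (mul_le_mul_of_nonneg_right (sum_lag_sq_le _ _) (by positivity))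
  have hp : ∀ᵐ ω ∂μ, nsq (cen (x (t + 1 + p) ω)) ≤ α ^ 2 * (4 * ((t + 1 : ℕ) : ℝ) ^ 2 * L ^ 2 *
      ∑ q ∈ Finset.range p, lag (t + 1) (p - q) * nsq (x (t + q + 1) ω - x (t + q) ω)
      + (4 * nsq (S (t + 1) ω) + 4 * nsq (S t ω))) := by
    filter_upwards [h.dev] with ω hω
    rw [hω p, nsq_smul, neg_sq]
    refine mul_le_mul_of_nonneg_left ((nsq_cen_le hn _).trans ?_) (sq_nonneg _)
    have e1 : ∑ q ∈ Finset.range p, lag (t + 1) (p - q) • mix (M p q)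
          ((trueGrad P F (x (t + q + 1) ω) - trueGrad P F (x (t + q) ω))
            + (N (t + q + 1) ω - N (t + q) ω))
        = (∑ q ∈ Finset.range p, lag (t + 1) (p - q) • mix (M p q)
          (trueGrad P F (x (t + q + 1) ω) - trueGrad P F (x (t + q) ω)))
          + (S (t + 1) ω - S t ω) := by
      simp only [hSdef, ← Finset.sum_sub_distrib, ← Finset.sum_add_distrib, ← smul_sub,
        ← smul_add, ← mix_sub, ← mix_add, add_right_comm t 1]
    rw [e1]
    have h1 := nsq_add_le (∑ q ∈ Finset.range p, lag (t + 1) (p - q) • mix (M p q)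
      (trueGrad P F (x (t + q + 1) ω) - trueGrad P F (x (t + q) ω))) (S (t + 1) ω - S t ω)
    have h2 := nsq_sub_le (S (t + 1) ω) (S t ω)
    have h3 := nsq_sum_smul_le (Finset.range p) (fun q => lag (t + 1) (p - q))
      (fun q _ => lag_nonneg _ _) fun q => mix (M p q)
        (trueGrad P F (x (t + q + 1) ω) - trueGrad P F (x (t + q) ω))
    have h4 : ∑ q ∈ Finset.range p, lag (t + 1) (p - q) * nsq (mix (M p q)
        (trueGrad P F (x (t + q + 1) ω) - trueGrad P F (x (t + q) ω)))
        ≤ L ^ 2 * ∑ q ∈ Finset.range p,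
          lag (t + 1) (p - q) * nsq (x (t + q + 1) ω - x (t + q) ω) := by
      rw [Finset.mul_sum]
      refine Finset.sum_le_sum fun q _ => ?_
      rw [mul_left_comm]
      exact mul_le_mul_of_nonneg_left ((nsq_mix_le (h.mem p q) _).trans
        (hS.nsq_trueGrad_sub_le _ _)) (lag_nonneg _ _)
    have h5 := mul_le_mul (sum_lag_sub_left_le (t + 1) p) h4
      (Finset.sum_nonneg fun q _ => mul_nonneg (lag_nonneg _ _) (nsq_nonneg _)) (by positivity)
    linarith
  have ix : ∀ q, Integrable (fun ω => lag (t + 1) (p - q) *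
      nsq (x (t + q + 1) ω - x (t + q) ω)) μ := fun q =>
    (h.sqInt_sub hS h0 _).integrable_nsq.const_mul _
  have ixs := (integrable_finsetSum (Finset.range p) fun q _ => ix q).const_mul
    (4 * ((t + 1 : ℕ) : ℝ) ^ 2 * L ^ 2)
  have iS := ((hSi (t + 1)).const_mul 4).add ((hSi t).const_mul 4)
  have hle := integral_mono_ae (h.sqInt_cen hS h0 _).integrable_nsq
    ((ixs.add iS).const_mul (α ^ 2)) hp
  have e1 := integral_add ixs iS
  have e2 := integral_add ((hSi (t + 1)).const_mul 4) ((hSi t).const_mul 4)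
  have e3 := integral_finsetSum (Finset.range p) fun q _ => ix q
  simp only [Pi.add_apply, integral_const_mul] at e1 e2 e3 hle
  rw [e1, e2, e3] at hle
  refine hle.trans (mul_le_mul_of_nonneg_left ?_ (sq_nonneg α))
  linarith [hSb (t + 1), hSb t]

/-- The next objective value lies between `optVal P F` and the integrable upper bound of the descent
lemma. -/
lemma TrackedRun.integrable_obj [IsProbabilityMeasure μ]
    (h : TrackedRun μ P F x N M α σ t) (hS : SmoothProblem P F L)
    (h0 : Integrable (fun ω => obj P F (avg (x 0 ω))) μ) (k : ℕ) :
    Integrable (fun ω => obj P F (avg (x k ω))) μ := by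
  induction k with
  | zero => exact h0
  | succ k ih =>
    have hg := h.memLp_gradient hS h0 k
    have hv := h.memLp_avg_sub hS (h.sqInt_cen hS h0 k) hg
    have hm : Measurable fun ω => obj P F (avg (x (k + 1) ω)) :=
      hS.differentiable_obj.continuous.measurable.comp (measurable_avg.comp (h.measurable _))
    refine integrable_of_le_of_le hm.aestronglyMeasurable
      (ae_of_all _ fun ω => hS.optVal_le _) (ae_of_all _ fun ω => ?_) (integrable_const _)
      ((ih.add (integrable_inner_of_memLp hg hv)).add
        ((hv.integrable_norm_pow (by norm_num)).const_mul (L / 2)))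
    have := le_add_inner_gradient hS.differentiable_obj hS.lipschitz_obj (avg (x k ω))
      (avg (x (k + 1) ω) - avg (x k ω))
    rwa [add_sub_cancel] at this

lemma TrackedRun.integral_obj_step_le [IsProbabilityMeasure μ]
    (h : TrackedRun μ P F x N M α σ t) (hS : SmoothProblem P F L) (hα : 0 ≤ α) (hn : 1 ≤ n)
    (hαL : L * α ≤ 1 / 2)
    (h0 : Integrable (fun ω => obj P F (avg (x 0 ω))) μ) (k : ℕ) :
    ∫ ω, obj P F (avg (x (k + 1) ω)) ∂μ ≤ ∫ ω, obj P F (avg (x k ω)) ∂μ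
      - α / 2 * ∫ ω, ‖gradient (obj P F) (avg (x k ω))‖ ^ 2 ∂μ
      - α / 4 * ∫ ω, ‖avg (trueGrad P F (x k ω))‖ ^ 2 ∂μ
      + α * L ^ 2 / (2 * n) * ∫ ω, nsq (cen (x k ω)) ∂μ + L * α ^ 2 * σ ^ 2 / (2 * n) := by
  have hL := hS.pos
  have ha := h.memLp_avg_trueGrad hS h0 k
  have hg := h.memLp_gradient hS h0 k
  have he := (h.sqInt_noise k).memLp_avg
  have ia := (ha.integrable_norm_pow (p := 2) (by norm_num)).const_mul (α / 2 * (1 - L * α))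
  have ig := (hg.integrable_norm_pow (p := 2) (by norm_num)).const_mul (α / 2)
  have ie := (he.integrable_norm_pow (p := 2) (by norm_num)).const_mul (L * α ^ 2 / 2)
  have iae := (integrable_inner_of_memLp ha he).const_mul (L * α ^ 2)
  have ige := (integrable_inner_of_memLp hg he).const_mul α
  have ic := (h.sqInt_cen hS h0 k).integrable_nsq.const_mul (α * L ^ 2 / (2 * n))
  have io := h.integrable_obj hS h0
  have i1 := (io k).sub ig
  have i2 := i1.sub ia
  have i3 := i2.add ic
  have i4 := i3.add ie
  have i5 := i4.sub ige
  have hle := integral_mono (io (k + 1)) (i5.add iae) fun ω => by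
    have := hS.obj_step_le hα (x k ω) (avg (N k ω))
    rwa [← h.step] at this
  have e1 := integral_add i5 iae
  have e2 := integral_sub i4 ige
  have e3 := integral_add i3 ie
  have e4 := integral_add i2 ic
  have e5 := integral_sub i1 ia
  have e6 := integral_sub (io k) ig
  simp only [Pi.add_apply, Pi.sub_apply] at e1 e2 e3 e4 e5 e6 hle
  rw [e1, e2, e3, e4, e5, e6] at hle
  simp only [integral_const_mul] at hle
  rw [h.integral_inner_avg_noise (ψ := fun v => avg (trueGrad P F v)) k
      (measurable_avg.comp hS.measurable_trueGrad) ha,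
    h.integral_inner_avg_noise (ψ := fun v => gradient (obj P F) (avg v)) k
      (hS.continuous_gradient_obj.measurable.comp measurable_avg) hg] at hle
  have h1 := mul_le_mul_of_nonneg_left (h.integral_norm_avg_noise_sq_le hn k)
    (by positivity : 0 ≤ L * α ^ 2 / 2)
  have h2 : L * α ^ 2 / 2 * (σ ^ 2 / n) = L * α ^ 2 * σ ^ 2 / (2 * n) := by
    field_simp
  have h3 : 0 ≤ ∫ ω, ‖avg (trueGrad P F (x k ω))‖ ^ 2 ∂μ :=
    integral_nonneg fun _ => sq_nonneg _
  -- The condition `L * α ≤ 1 / 2` preserves half of the coefficient of the averaged gradient.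
  have h4 : α / 4 ≤ α / 2 * (1 - L * α) := by nlinarith
  have h5 := mul_le_mul_of_nonneg_right h4 h3
  rw [h2] at h1
  linarith

end Run

/-! ### From the recursions to the rate -/

section Rate

/-- The consensus errors `D` are controlled by the averaged gradients `A`. -/
lemma sum_consensus_le {D A X : ℕ → ℝ} {L σ α n : ℝ} {t R : ℕ} (hn : 0 ≤ n)
    (hD : ∀ k, 0 ≤ D k) (hA : ∀ k, 0 ≤ A k) (hX : ∀ k, 0 ≤ X k)
    (hD0 : ∀ k ≤ t + 1, D k = 0)
    (hDX : ∀ p, D (t + 1 + p) ≤ α ^ 2 * (4 * ((t + 1 : ℕ) : ℝ) ^ 2 * L ^ 2 *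
      ∑ q ∈ Finset.range p, lag (t + 1) (p - q) * X (t + q)
      + 32 * ((t + 1 : ℕ) : ℝ) ^ 3 * n * σ ^ 2))
    (hXD : ∀ k, X k ≤ 2 * D (k + 1) + 2 * D k + n * α ^ 2 * A k + α ^ 2 * σ ^ 2)
    (hα : α ^ 2 * L ^ 2 * ((t + 1 : ℕ) : ℝ) ^ 4 ≤ 1 / 48) :
    ∑ k ∈ Finset.range (t + 1 + R + 1), D k ≤
      n * α ^ 2 / 2 * ∑ k ∈ Finset.range (t + 1 + R + 1), A k
      + (t + 1 + R + 1 : ℕ) * (α ^ 2 * σ ^ 2 / 2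
        + 96 * α ^ 2 * ((t + 1 : ℕ) : ℝ) ^ 3 * n * σ ^ 2) := by
  set τ : ℝ := ((t + 1 : ℕ) : ℝ) with hτ
  set K := t + 1 + R + 1 with hK
  have h1 : ∑ k ∈ Finset.range K, D k = ∑ p ∈ Finset.range (R + 1), D (t + 1 + p) := by
    rw [hK, add_assoc (t + 1), Finset.sum_range_add, Finset.sum_eq_zero, zero_add]
    exact fun k hk => hD0 k (Finset.mem_range.1 hk).le
  have h2 : ∑ p ∈ Finset.range (R + 1), D (t + 1 + p) ≤ α ^ 2 * (4 * τ ^ 2 * L ^ 2 *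
      (2 * τ ^ 2 * ∑ q ∈ Finset.range R, X (t + q)) + K * (32 * τ ^ 3 * n * σ ^ 2)) := by
    refine (Finset.sum_le_sum fun p _ => hDX p).trans ?_
    rw [← Finset.mul_sum, Finset.sum_add_distrib, ← Finset.mul_sum, Finset.sum_const,
      Finset.card_range, nsmul_eq_mul]
    have h3 := sum_sum_lag_mul_le (t + 1) R (fun q => X (t + q)) fun q => hX _
    have h4 : ((R + 1 : ℕ) : ℝ) ≤ K := Nat.cast_le.2 (by omega)
    gcongr
  have hsub : ∀ (Y : ℕ → ℝ) (r : ℕ), (∀ k, 0 ≤ Y k) → r ≤ t + 1 →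
      ∑ q ∈ Finset.range R, Y (r + q) ≤ ∑ k ∈ Finset.range K, Y k := by
    intro Y r hY hr
    have h5 : ∑ k ∈ Finset.range (r + R), Y k ≤ ∑ k ∈ Finset.range K, Y k :=
      Finset.sum_le_sum_of_subset_of_nonneg (Finset.range_subset_range.2 (by omega))
        fun k _ _ => hY k
    rw [Finset.sum_range_add] at h5
    have h6 : 0 ≤ ∑ k ∈ Finset.range r, Y k := Finset.sum_nonneg fun k _ => hY k
    linarith
  have h3 : ∑ q ∈ Finset.range R, X (t + q) ≤ 4 * ∑ k ∈ Finset.range K, D k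
      + n * α ^ 2 * ∑ k ∈ Finset.range K, A k + K * (α ^ 2 * σ ^ 2) := by
    refine (Finset.sum_le_sum fun q _ => hXD (t + q)).trans ?_
    simp only [Finset.sum_add_distrib, ← Finset.mul_sum, Finset.sum_const, Finset.card_range,
      nsmul_eq_mul]
    have h4 := hsub D (t + 1) hD le_rfl
    have h5 := hsub D t hD (by omega)
    have h6 := mul_le_mul_of_nonneg_left (hsub A t hA (by omega))
      (by positivity : 0 ≤ n * α ^ 2)
    have h7 : (R : ℝ) * (α ^ 2 * σ ^ 2) ≤ K * (α ^ 2 * σ ^ 2) := by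
      have : (R : ℝ) ≤ K := Nat.cast_le.2 (by omega)
      gcongr
    have h8 : ∀ q, t + q + 1 = t + 1 + q := fun q => by omega
    simp only [h8]
    linarith
  rw [h1] at h3 ⊢
  set S := ∑ p ∈ Finset.range (R + 1), D (t + 1 + p)
  set SA := ∑ k ∈ Finset.range K, A k
  have h4 : 0 ≤ ∑ q ∈ Finset.range R, X (t + q) := Finset.sum_nonneg fun q _ => hX _
  -- Here `8 / 48 = 1 / 6`. With the factor 4 in `h3`, two thirds of the consensus error reappear on
  -- the right; absorbing them multiplies the remaining terms by 3, giving `1 / 2` and 96.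
  have h5 : α ^ 2 * (4 * τ ^ 2 * L ^ 2 * (2 * τ ^ 2 * ∑ q ∈ Finset.range R, X (t + q)))
      ≤ 1 / 6 * ∑ q ∈ Finset.range R, X (t + q) := by
    have := mul_le_mul_of_nonneg_right hα h4
    linarith
  linarith

/-- Summing the descent inequalities for the objective values `f`. -/
lemma sum_gradients_le {f D A G : ℕ → ℝ} {L σ α n τ fmin Δ : ℝ} {K : ℕ} (hn : 1 ≤ n)
    (hα : 0 < α) (hL : 0 < L) (hαL : L * α ≤ 1 / 2) (hτ : 1 ≤ τ)
    (hA : ∀ k, 0 ≤ A k) (hG : ∀ k, 0 ≤ G k) (hf : ∀ k, fmin ≤ f k) (hΔ : f 0 - fmin ≤ Δ)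
    (hstep : ∀ k, f (k + 1) ≤ f k - α / 2 * G k - α / 4 * A k
      + α * L ^ 2 / (2 * n) * D k + L * α ^ 2 * σ ^ 2 / (2 * n))
    (hsum : ∑ k ∈ Finset.range K, D k ≤ n * α ^ 2 / 2 * ∑ k ∈ Finset.range K, A k
      + K * (α ^ 2 * σ ^ 2 / 2 + 96 * α ^ 2 * τ ^ 3 * n * σ ^ 2)) :
    ∑ k ∈ Finset.range K, (A k + G k) ≤ 8 * (Δ / α)
      + K * (4 * (L * σ ^ 2 / n * α) + 392 * (τ ^ 3 * L ^ 2 * σ ^ 2 * α ^ 2)) := by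
  have h1 : ∀ K, f K ≤ f 0 - α / 2 * ∑ k ∈ Finset.range K, G k
      - α / 4 * ∑ k ∈ Finset.range K, A k + α * L ^ 2 / (2 * n) * ∑ k ∈ Finset.range K, D k
      + K * (L * α ^ 2 * σ ^ 2 / (2 * n)) := by
    intro K
    induction K with
    | zero => simp
    | succ K ih =>
      simp only [Finset.sum_range_succ]
      push_cast
      linarith [hstep K]
  have hSA : 0 ≤ ∑ k ∈ Finset.range K, A k := Finset.sum_nonneg fun k _ => hA k
  have hSG : 0 ≤ ∑ k ∈ Finset.range K, G k := Finset.sum_nonneg fun k _ => hG k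
  rw [Finset.sum_add_distrib]
  have h2 := h1 K
  have h3 := hf K
  have h4 := mul_le_mul_of_nonneg_left hsum (by positivity : 0 ≤ α * L ^ 2 / (2 * n))
  set SA := ∑ k ∈ Finset.range K, A k
  set SG := ∑ k ∈ Finset.range K, G k
  have hn0 : (n : ℝ) ≠ 0 := by positivity
  have h5 : α * L ^ 2 / (2 * n) * (n * α ^ 2 / 2 * SA + K * (α ^ 2 * σ ^ 2 / 2
      + 96 * α ^ 2 * τ ^ 3 * n * σ ^ 2)) = α / 4 * (L * α) ^ 2 * SA
      + K * (α ^ 3 * L ^ 2 * σ ^ 2 * (1 / (4 * n) + 48 * τ ^ 3)) := by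
    field_simp
    ring
  have h6 : (L * α) ^ 2 ≤ 1 / 4 := by
    have : 0 < L * α := by positivity
    nlinarith
  -- The descent provides `α / 4 * SA`, so at least `α / 8 * SA` survives; the final factor `8 / α`
  -- produces the constants 8, 4 and `392 = 8 * 49`.
  have h7 : α / 4 * (L * α) ^ 2 * SA ≤ α / 16 * SA := by
    refine mul_le_mul_of_nonneg_right ?_ hSA
    nlinarith
  have h8 : 1 / (4 * n) + 48 * τ ^ 3 ≤ 49 * τ ^ 3 := by
    have : 1 ≤ τ ^ 3 := one_le_pow₀ hτ
    have : 1 / (4 * n) ≤ 1 := by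
      rw [div_le_one (by positivity)]; linarith
    linarith
  have h9 : (K : ℝ) * (α ^ 3 * L ^ 2 * σ ^ 2 * (1 / (4 * n) + 48 * τ ^ 3))
      ≤ K * (α ^ 3 * L ^ 2 * σ ^ 2 * (49 * τ ^ 3)) := by gcongr
  have h10 : α / 8 * (SA + SG) ≤ α / 8 * (8 * (Δ / α)
      + K * (4 * (L * σ ^ 2 / n * α) + 392 * (τ ^ 3 * L ^ 2 * σ ^ 2 * α ^ 2))) := by
    have e : α / 8 * (8 * (Δ / α)
      + K * (4 * (L * σ ^ 2 / n * α) + 392 * (τ ^ 3 * L ^ 2 * σ ^ 2 * α ^ 2)))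
      = Δ + K * (L * α ^ 2 * σ ^ 2 / (2 * n)) + K * (α ^ 3 * L ^ 2 * σ ^ 2 * (49 * τ ^ 3)) := by
      field_simp
      ring
    rw [e]
    have h11 : 0 ≤ α * SA := by positivity
    have h12 : 0 ≤ α * SG := by positivity
    linarith
  exact le_of_mul_le_mul_left h10 (by positivity)

/-! ### Consequences of the choice of the step size. -/

lemma stepSize_pos {n τ T : ℕ} {L σ : ℝ} (hn : 1 ≤ n) (hτ : 1 ≤ τ) (hT : 1 ≤ T) (hL : 0 < L)
    (hσ : 0 < σ) : 0 < stepSize n τ T L σ := by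
  have : (0 : ℝ) < n := by positivity
  have : (0 : ℝ) < τ := by positivity
  have : (0 : ℝ) < T := by positivity
  unfold stepSize
  simp only [lt_min_iff]
  refine ⟨⟨?_, ?_⟩, ?_, ?_⟩ <;> positivity

lemma mul_stepSize_le {n τ T : ℕ} {L σ : ℝ} (hL : 0 < L) : L * stepSize n τ T L σ ≤ 1 / 2 := by
  have h : stepSize n τ T L σ ≤ 1 / (2 * L) := (min_le_right _ _).trans (min_le_left _ _)
  refine (mul_le_mul_of_nonneg_left h hL.le).trans_eq ?_
  field_simp

lemma stepSize_sq_mul_le {n τ T : ℕ} {L σ : ℝ} (hn : 1 ≤ n) (hτ : 1 ≤ τ) (hT : 1 ≤ T)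
    (hL : 0 < L) (hσ : 0 < σ) : stepSize n τ T L σ ^ 2 * L ^ 2 * (τ : ℝ) ^ 4 ≤ 1 / 48 := by
  have h : stepSize n τ T L σ ≤ 1 / (4 * Real.sqrt 3 * (τ : ℝ) ^ 2 * L) :=
    (min_le_right _ _).trans (min_le_right _ _)
  have hτ' : (0 : ℝ) < τ := by positivity
  have h2 := pow_le_pow_left₀ (stepSize_pos hn hτ hT hL hσ).le h 2
  calc _ = stepSize n τ T L σ ^ 2 * (L ^ 2 * (τ : ℝ) ^ 4) := by ring
    _ ≤ (1 / (4 * Real.sqrt 3 * (τ : ℝ) ^ 2 * L)) ^ 2 * (L ^ 2 * (τ : ℝ) ^ 4) := by gcongr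
    _ = 1 / (16 * Real.sqrt 3 ^ 2) := by field_simp; norm_num
    _ = 1 / 48 := by rw [Real.sq_sqrt (by norm_num)]; norm_num

lemma mul_stepSize_le_rpow {n τ T : ℕ} {L σ : ℝ} (hn : 1 ≤ n) (hT : 1 ≤ T) (hL : 0 < L)
    (hσ : 0 < σ) :
    L * σ ^ 2 / n * stepSize n τ T L σ ≤ (L * σ ^ 2 / (n * T)) ^ (1 / 2 : ℝ) := by
  have hn' : (0 : ℝ) < n := by positivity
  have hT' : (0 : ℝ) < T := by positivity
  have h : stepSize n τ T L σ ≤ (1 / (L * σ ^ 2 / n * T)) ^ (1 / 2 : ℝ) :=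
    (min_le_left _ _).trans (min_le_left _ _)
  refine (mul_le_mul_of_nonneg_left h (by positivity)).trans_eq ?_
  rw [← Real.sqrt_eq_rpow, ← Real.sqrt_eq_rpow]
  refine ((Real.sqrt_eq_iff_mul_self_eq (by positivity) (by positivity)).2 ?_).symm
  rw [mul_mul_mul_comm, Real.mul_self_sqrt (by positivity)]
  field_simp

lemma rpow_third_cube {a : ℝ} (ha : 0 ≤ a) : (a ^ (1 / 3 : ℝ)) ^ 3 = a := by
  rw [← Real.rpow_natCast, ← Real.rpow_mul ha]; norm_num

lemma rpow_two_thirds_cube {a : ℝ} (ha : 0 ≤ a) : (a ^ (2 / 3 : ℝ)) ^ 3 = a ^ 2 := by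
  rw [← Real.rpow_natCast, ← Real.rpow_mul ha]; norm_num

/-- Inserting the second entry of the minimum gives `c₂ * α ^ 2 ≤ (c₂ / T ^ 2) ^ (1 / 3)`, which is
the right-hand side; cubing removes the fractional exponents. -/
lemma mul_stepSize_sq_le_rpow {n τ T : ℕ} {L σ : ℝ} (hn : 1 ≤ n) (hτ : 1 ≤ τ) (hT : 1 ≤ T)
    (hL : 0 < L) (hσ : 0 < σ) :
    (τ : ℝ) ^ 3 * L ^ 2 * σ ^ 2 * stepSize n τ T L σ ^ 2 ≤ τ * (L * σ / T) ^ (2 / 3 : ℝ) := by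
  have hτ' : (0 : ℝ) < τ := by positivity
  have hT' : (0 : ℝ) < T := by positivity
  have h : stepSize n τ T L σ ≤ (1 / ((τ : ℝ) ^ 3 * L ^ 2 * σ ^ 2 * T)) ^ (1 / 3 : ℝ) :=
    (min_le_left _ _).trans (min_le_right _ _)
  have h2 := pow_le_pow_left₀ (stepSize_pos hn hτ hT hL hσ).le h 2
  refine (mul_le_mul_of_nonneg_left h2 (by positivity)).trans ?_
  refine le_of_pow_le_pow_left₀ (n := 3) (by norm_num) (by positivity) (le_of_eq ?_)
  rw [mul_pow, ← pow_mul, mul_comm 2 3, pow_mul, rpow_third_cube (by positivity), mul_pow (τ : ℝ),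
    rpow_two_thirds_cube (by positivity)]
  field_simp

/-- The reciprocal of a minimum of positive numbers is at most the sum of the reciprocals. -/
lemma inv_min_le_add {a b : ℝ} (ha : 0 < a) (hb : 0 < b) : (min a b)⁻¹ ≤ a⁻¹ + b⁻¹ := by
  have := inv_pos.2 ha
  have := inv_pos.2 hb
  rcases min_choice a b with h | h <;> rw [h] <;> linarith

lemma inv_stepSize_div_le {n τ T : ℕ} {L σ : ℝ} (hn : 1 ≤ n) (hτ : 1 ≤ τ) (hT : 1 ≤ T)
    (hL : 0 < L) (hσ : 0 < σ) :
    (stepSize n τ T L σ)⁻¹ / T ≤ 9 * ((τ : ℝ) ^ 2 * L / T) + τ * (L * σ / T) ^ (2 / 3 : ℝ)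
      + (L * σ ^ 2 / (n * T)) ^ (1 / 2 : ℝ) := by
  have hn' : (0 : ℝ) < n := by positivity
  have hτ' : (1 : ℝ) ≤ τ := by exact_mod_cast hτ
  have hτ0 : (0 : ℝ) < τ := by positivity
  have hT' : (0 : ℝ) < T := by positivity
  set a : ℝ := (1 / (L * σ ^ 2 / n * T)) ^ (1 / 2 : ℝ) with ha
  set b : ℝ := (1 / ((τ : ℝ) ^ 3 * L ^ 2 * σ ^ 2 * T)) ^ (1 / 3 : ℝ) with hb
  have ha0 : 0 < a := by positivity
  have hb0 : 0 < b := by positivity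
  have h1 : (stepSize n τ T L σ)⁻¹ ≤ a⁻¹ + b⁻¹ +
      ((1 / (2 * L))⁻¹ + (1 / (4 * Real.sqrt 3 * (τ : ℝ) ^ 2 * L))⁻¹) :=
    (inv_min_le_add (lt_min ha0 hb0) (lt_min (by positivity) (by positivity))).trans
      (add_le_add (inv_min_le_add ha0 hb0) (inv_min_le_add (by positivity) (by positivity)))
  have h2 : a⁻¹ / T = (L * σ ^ 2 / (n * T)) ^ (1 / 2 : ℝ) := by
    rw [ha, ← Real.sqrt_eq_rpow, ← Real.sqrt_eq_rpow]
    refine ((Real.sqrt_eq_iff_mul_self_eq (by positivity) (by positivity)).2 ?_).symm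
    rw [div_mul_div_comm, ← mul_inv, Real.mul_self_sqrt (by positivity)]
    field_simp
  have h3 : b⁻¹ / T = τ * (L * σ / T) ^ (2 / 3 : ℝ) := by
    refine (pow_left_inj₀ (n := 3) (by positivity) (by positivity) (by norm_num)).1 ?_
    rw [div_pow, inv_pow, hb, rpow_third_cube (by positivity), mul_pow,
      rpow_two_thirds_cube (by positivity)]
    field_simp
  have h4 : (1 / (2 * L))⁻¹ + (1 / (4 * Real.sqrt 3 * (τ : ℝ) ^ 2 * L))⁻¹
      ≤ 9 * ((τ : ℝ) ^ 2 * L) := by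
    rw [one_div, inv_inv, one_div, inv_inv]
    -- This rational bound makes the constant `2 + 4 * (7 / 4) = 9`.
    have h5 : Real.sqrt 3 ≤ 7 / 4 := Real.sqrt_le_iff.2 ⟨by norm_num, by norm_num⟩
    have h6 : (1 : ℝ) ≤ (τ : ℝ) ^ 2 := one_le_pow₀ hτ'
    have h7 : L ≤ (τ : ℝ) ^ 2 * L := by nlinarith
    have h8 : Real.sqrt 3 * ((τ : ℝ) ^ 2 * L) ≤ 7 / 4 * ((τ : ℝ) ^ 2 * L) := by gcongr
    linarith
  calc _ ≤ (a⁻¹ + b⁻¹ + 9 * ((τ : ℝ) ^ 2 * L)) / T := by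
        gcongr; linarith
    _ = _ := by rw [add_div, add_div, h2, h3]; ring

end Rate

/-! ### Assembling the theorem -/

section Assembly

variable {n d : ℕ} {Ω : Type*} {mΩ : MeasurableSpace Ω} {μ : Measure Ω}

lemma meanSq_eq_ofReal {X : Ω → Vec d} (hX : MemLp X 2 μ) :
    meanSq μ X = ENNReal.ofReal (∫ ω, ‖X ω‖ ^ 2 ∂μ) := by
  rw [ofReal_integral_eq_lintegral_ofReal (hX.integrable_norm_pow (by norm_num))
    (ae_of_all _ fun _ => sq_nonneg _)]
  refine lintegral_congr fun ω => ?_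
  rw [ENNReal.ofReal_pow (norm_nonneg _), ofReal_norm]

lemma cen_ae_eq_zero_of_consensusError {x : Ω → Fin n → Vec d} (hx : Measurable x)
    (h : consensusError μ x = 0) : ∀ᵐ ω ∂μ, cen (x ω) = 0 := by
  have h1 : ∀ i, ∀ᵐ ω ∂μ, cen (x ω) i = 0 := by
    intro i
    have h2 : meanSq μ (fun ω => x ω i - avg (x ω)) = 0 :=
      (Finset.sum_eq_zero_iff.1 h) i (Finset.mem_univ i)
    have hm : Measurable fun ω => x ω i - avg (x ω) :=
      ((measurable_pi_apply i).comp hx).sub (measurable_avg.comp hx)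
    have h3 := (lintegral_eq_zero_iff (hm.enorm.pow_const 2)).1 h2
    filter_upwards [h3] with ω hω
    simpa [cen] using hω
  filter_upwards [ae_all_iff.2 h1] with ω hω
  exact funext hω

lemma cen_sum {ι : Type*} (s : Finset ι) (v : ι → Fin n → Vec d) :
    cen (∑ i ∈ s, v i) = ∑ i ∈ s, cen (v i) := by
  classical
  induction s using Finset.induction_on with
  | empty => ext1 i; simp [cen, avg]
  | insert a s ha ih => rw [Finset.sum_insert ha, Finset.sum_insert ha, cen_add, ih]

variable {Ξ : Fin n → Type*} [∀ i, MeasurableSpace (Ξ i)]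
  {P : ∀ i, Measure (Ξ i)} {F : ∀ i, Vec d → Ξ i → ℝ} {L σ α : ℝ}
  {W V U : ℕ → Matrix (Fin n) (Fin n) ℝ} {t : ℕ}
  {x₀ : Ω → Fin n → Vec d} {ξ : ℕ → ∀ i, Ω → Ξ i}

lemma isTracking_gradTracking {Ξ : Fin n → Type*} (F : ∀ i, Vec d → Ξ i → ℝ) (A B : ℕ → Matrix (Fin n) (Fin n) ℝ)
    (α : ℝ) (x₀ : Fin n → Vec d) (ζ : ℕ → ∀ i, Ξ i) :
    IsTracking A B α (fun k => (gradTracking F A B α x₀ ζ k).1)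
      (fun k => (gradTracking F A B α x₀ ζ k).2)
      (fun k => stochGrad F (gradTracking F A B α x₀ ζ k).1 (ζ k)) :=
  ⟨rfl, fun _ => rfl, fun _ => rfl⟩

lemma trackedRun_iterates [IsProbabilityMeasure μ] (hF : LossRegular P F)
    (hS : SmoothProblem P F L) (hn : 1 ≤ n) (hα : α ≠ 0) (hW : FiniteTimeConsensus (t + 1) W)
    (hV : ∀ k < t + 1, V k ∈ doublyStochastic ℝ (Fin n))
    (hU : ∀ k ≤ t + 1, U k ∈ doublyStochastic ℝ (Fin n))
    (hN : NoiseAssumption μ P F (iterates F (t + 1) W V U α x₀ ξ) ξ σ)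
    (hc : ∑ k ∈ Finset.range (t + 1 + 1),
      consensusError μ (iterates F (t + 1) W V U α x₀ ξ k) = 0) :
    TrackedRun μ P F (iterates F (t + 1) W V U α x₀ ξ)
      (fun k ω i => noise P F (iterates F (t + 1) W V U α x₀ ξ) ξ k i ω)
      (fun p q => sweep (fun l => W ((q + l) % (t + 1))) (p - q)
        * trackSchedule (t + 1) U (t + 1 + q)) α σ t := by
  set x := iterates F (t + 1) W V U α x₀ ξ with hxdef
  have hx : ∀ k, Measurable (x k) :=
    measurable_iterates hF hN.measurable_init hN.measurable_sample
  have htr := fun ω => isTracking_gradTracking F (mixSchedule (t + 1) V W)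
    (trackSchedule (t + 1) U) α (x₀ ω) (fun j i => ξ j i ω)
  have hs : ∀ k ω, stochGrad F (x k ω) (fun i => ξ k i ω)
      = trueGrad P F (x k ω) + fun i => noise P F x ξ k i ω := by
    intro k ω
    ext1 i
    simp [noise]
  have hwarm : ∀ᵐ ω ∂μ, ∀ k ≤ t + 1, cen (x k ω) = 0 := by
    refine ae_all_iff.2 fun k => ?_
    by_cases hk : k ≤ t + 1
    · filter_upwards [cen_ae_eq_zero_of_consensusError (hx k)
        (Finset.sum_eq_zero_iff.1 hc k (Finset.mem_range.2 (by omega)))] with ω hω _ using hω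
    · exact ae_of_all _ fun ω h => absurd h hk
  refine ⟨hx, fun k i => hN.memLp k i, fun p q hpq => noise_orthogonal hF hS hN hpq,
    hN.integral_norm_sq_le hx, fun k i ψ hψ hψ2 => ?_, fun p q => ?_, fun k ω => ?_, hwarm, ?_⟩
  · exact integral_inner_noise_eq_zero hF hS hN (q := (k, i))
      (hψ.comp (measurable_others_iterates hF le_rfl)) hψ2
  · exact mul_mem (sweep_mem _ (fun l => hW.doublyStochastic _ (Nat.mod_lt _ hW.one_le)) _)
      (trackSchedule_mem hU _)
  · have := (htr ω).avg_x (mixSchedule_mem hW hV) (trackSchedule_mem hU) k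
    rw [← avg_add, ← hs]
    exact this
  · filter_upwards [hwarm] with ω hω p
    have := (htr ω).cen_eq hn hα hW hV hU (hω t (by omega)) (hω (t + 1) le_rfl) p
    refine this.trans ?_
    rw [cen_sum]
    congr 1
    refine Finset.sum_congr rfl fun q _ => ?_
    rw [cen_smul, cen_mix (mul_mem (sweep_mem _
      (fun l => hW.doublyStochastic _ (Nat.mod_lt _ hW.one_le)) _) (trackSchedule_mem hU _)),
      ← add_sub_add_comm, ← hs, ← hs]
    rfl

/-- A finite lower integral of the nonnegative gap yields integrability. The maximum accounts for
`ENNReal.ofReal` truncating a negative `Δ` to zero. -/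
lemma integrable_obj_of_lintegral [IsProbabilityMeasure μ] (hS : SmoothProblem P F L)
    {y : Ω → Vec d} (hy : Measurable y) {Δ : ℝ}
    (h : ∫⁻ ω, ENNReal.ofReal (obj P F (y ω) - optVal P F) ∂μ ≤ ENNReal.ofReal Δ) :
    Integrable (fun ω => obj P F (y ω)) μ ∧
      ∫ ω, obj P F (y ω) ∂μ - optVal P F ≤ max Δ 0 := by
  have hm : Measurable fun ω => obj P F (y ω) - optVal P F :=
    (hS.differentiable_obj.continuous.measurable.comp hy).sub_const _
  have hnn : 0 ≤ᵐ[μ] fun ω => obj P F (y ω) - optVal P F :=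
    ae_of_all _ fun ω => sub_nonneg.2 (hS.optVal_le _)
  have hi : Integrable (fun ω => obj P F (y ω) - optVal P F) μ :=
    ⟨hm.aestronglyMeasurable, (hasFiniteIntegral_iff_ofReal hnn).2
      (h.trans_lt ENNReal.ofReal_lt_top)⟩
  have hi' : Integrable (fun ω => obj P F (y ω)) μ := by
    refine (hi.add (integrable_const (optVal P F))).congr (ae_of_all _ fun ω => ?_)
    simp
  refine ⟨hi', ?_⟩
  rw [← ofReal_integral_eq_lintegral_ofReal hi hnn,
    integral_sub hi' (integrable_const _), integral_const] at h
  simp only [probReal_univ, one_smul] at h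
  rcases le_total 0 Δ with h0 | h0
  · exact ((ENNReal.ofReal_le_ofReal_iff h0).1 h).trans (le_max_left _ _)
  · rw [ENNReal.ofReal_of_nonpos h0, nonpos_iff_eq_zero, ENNReal.ofReal_eq_zero] at h
    exact h.trans (le_max_right _ _)

lemma TrackedRun.sum_le [IsProbabilityMeasure μ] {x N : ℕ → Ω → Fin n → Vec d}
    {M : ℕ → ℕ → Matrix (Fin n) (Fin n) ℝ} {Δ : ℝ} (h : TrackedRun μ P F x N M α σ t)
    (hS : SmoothProblem P F L) (hn : 1 ≤ n) (hα : 0 < α) (hαL : L * α ≤ 1 / 2)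
    (hατ : α ^ 2 * L ^ 2 * ((t + 1 : ℕ) : ℝ) ^ 4 ≤ 1 / 48)
    (h0 : Integrable (fun ω => obj P F (avg (x 0 ω))) μ)
    (hΔ : ∫ ω, obj P F (avg (x 0 ω)) ∂μ - optVal P F ≤ Δ) {T : ℕ} (hT : t + 1 ≤ T) :
    ∑ k ∈ Finset.range (T + 1), (∫ ω, ‖avg (trueGrad P F (x k ω))‖ ^ 2 ∂μ
        + ∫ ω, ‖gradient (obj P F) (avg (x k ω))‖ ^ 2 ∂μ)
      ≤ 8 * (Δ / α) + (T + 1 : ℕ) * (4 * (L * σ ^ 2 / n * α)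
        + 392 * (((t + 1 : ℕ) : ℝ) ^ 3 * L ^ 2 * σ ^ 2 * α ^ 2)) := by
  obtain ⟨R, rfl⟩ := Nat.exists_eq_add_of_le hT
  have hsum := sum_consensus_le (R := R) (Nat.cast_nonneg n)
    (fun k => integral_nonneg fun ω => nsq_nonneg (cen (x k ω)))
    (fun k => integral_nonneg fun ω => sq_nonneg ‖avg (trueGrad P F (x k ω))‖)
    (fun k => integral_nonneg fun ω => nsq_nonneg (x (k + 1) ω - x k ω))
    (fun k hk => h.integral_nsq_cen_eq_zero hk) (h.integral_nsq_cen_le hS h0 hn)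
    (h.integral_nsq_sub_le hS h0 hn) hατ
  refine sum_gradients_le (by exact_mod_cast hn) hα hS.pos hαL (Nat.one_le_cast.2 (by omega))
    (fun k => integral_nonneg fun ω => sq_nonneg _)
    (fun k => integral_nonneg fun ω => sq_nonneg _) (f := fun k => ∫ ω, obj P F (avg (x k ω)) ∂μ)
    (fun k => ?_) hΔ (h.integral_obj_step_le hS hα.le hn hαL h0) hsum
  have := integral_mono (integrable_const (optVal P F)) (h.integrable_obj hS h0 k)
    fun ω => hS.optVal_le _
  simpa using this

lemma TrackedRun.average_le [IsProbabilityMeasure μ] {x N : ℕ → Ω → Fin n → Vec d}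
    {M : ℕ → ℕ → Matrix (Fin n) (Fin n) ℝ} {Δ : ℝ} {T : ℕ}
    (h : TrackedRun μ P F x N M (stepSize n (t + 1) T L σ) σ t)
    (hS : SmoothProblem P F L) (hn : 1 ≤ n) (hσ : 0 < σ) (hΔ0 : 0 ≤ Δ)
    (h0 : Integrable (fun ω => obj P F (avg (x 0 ω))) μ)
    (hΔ : ∫ ω, obj P F (avg (x 0 ω)) ∂μ - optVal P F ≤ Δ) (hT : t + 1 ≤ T) :
    ((T : ℝ≥0∞) + 1)⁻¹ * ∑ k ∈ Finset.range (T + 1),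
        (meanSq μ (fun ω => avg (trueGrad P F (x k ω)))
          + meanSq μ (fun ω => gradient (obj P F) (avg (x k ω))))
      ≤ ENNReal.ofReal ((72 * Δ + 1) * ((t + 1 : ℕ) : ℝ) ^ 2 * L / T
          + (8 * Δ + 392) * ((t + 1 : ℕ) : ℝ) * (L * σ / T) ^ (2 / 3 : ℝ)
          + (8 * Δ + 4) * (L * σ ^ 2 / (n * T)) ^ (1 / 2 : ℝ)) := by
  have hL := hS.pos
  have hT1 : 1 ≤ T := by omega
  have hT0 : (0 : ℝ) < T := by positivity
  have hτ1 : 1 ≤ t + 1 := by omega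
  have hα := stepSize_pos hn hτ1 hT1 hL hσ
  have hsum := h.sum_le hS hn hα (mul_stepSize_le hL) (stepSize_sq_mul_le hn hτ1 hT1 hL hσ) h0 hΔ hT
  have e : ∑ k ∈ Finset.range (T + 1), (meanSq μ (fun ω => avg (trueGrad P F (x k ω)))
      + meanSq μ (fun ω => gradient (obj P F) (avg (x k ω))))
      = ENNReal.ofReal (∑ k ∈ Finset.range (T + 1), (∫ ω, ‖avg (trueGrad P F (x k ω))‖ ^ 2 ∂μ
        + ∫ ω, ‖gradient (obj P F) (avg (x k ω))‖ ^ 2 ∂μ)) := by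
    have hnn : ∀ Y : Ω → Vec d, 0 ≤ ∫ ω, ‖Y ω‖ ^ 2 ∂μ :=
      fun Y => integral_nonneg fun ω => sq_nonneg _
    rw [ENNReal.ofReal_sum_of_nonneg fun k _ => add_nonneg (hnn _) (hnn _)]
    refine Finset.sum_congr rfl fun k _ => ?_
    rw [ENNReal.ofReal_add (hnn _) (hnn _), meanSq_eq_ofReal (h.memLp_avg_trueGrad hS h0 k),
      meanSq_eq_ofReal (h.memLp_gradient hS h0 k)]
  have e2 : ((T : ℝ≥0∞) + 1)⁻¹ = ENNReal.ofReal ((T + 1 : ℝ)⁻¹) := by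
    rw [ENNReal.ofReal_inv_of_pos (by positivity), ENNReal.ofReal_add hT0.le zero_le_one,
      ENNReal.ofReal_natCast, ENNReal.ofReal_one]
  rw [e, e2, ← ENNReal.ofReal_mul (by positivity)]
  refine ENNReal.ofReal_le_ofReal ?_
  have h1 := inv_stepSize_div_le hn hτ1 hT1 hL hσ
  have h2 := mul_stepSize_le_rpow (τ := t + 1) hn hT1 hL hσ
  have h3 := mul_stepSize_sq_le_rpow hn hτ1 hT1 hL hσ
  set α := stepSize n (t + 1) T L σ
  set τ : ℝ := ((t + 1 : ℕ) : ℝ)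
  set r := (L * σ / T) ^ (2 / 3 : ℝ)
  set s := (L * σ ^ 2 / (n * T)) ^ (1 / 2 : ℝ)
  have h4 : (T + 1 : ℝ)⁻¹ * (8 * (Δ / α)) ≤ 8 * Δ * (9 * (τ ^ 2 * L / T) + τ * r + s) := by
    have : (T + 1 : ℝ)⁻¹ ≤ (T : ℝ)⁻¹ := inv_anti₀ hT0 (by linarith)
    calc (T + 1 : ℝ)⁻¹ * (8 * (Δ / α)) ≤ (T : ℝ)⁻¹ * (8 * (Δ / α)) := by gcongr
      _ = 8 * Δ * (α⁻¹ / T) := by ring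
      _ ≤ _ := by gcongr
  have h5 : 0 ≤ τ ^ 2 * L / T := by positivity
  calc _ ≤ (T + 1 : ℝ)⁻¹ * (8 * (Δ / α) + (T + 1 : ℕ) * (4 * (L * σ ^ 2 / n * α)
        + 392 * (τ ^ 3 * L ^ 2 * σ ^ 2 * α ^ 2))) := by gcongr
    _ = (T + 1 : ℝ)⁻¹ * (8 * (Δ / α)) + (4 * (L * σ ^ 2 / n * α)
        + 392 * (τ ^ 3 * L ^ 2 * σ ^ 2 * α ^ 2)) := by
      push_cast
      rw [mul_add, ← mul_assoc (T + 1 : ℝ)⁻¹ (T + 1 : ℝ), inv_mul_cancel₀ (by positivity), one_mul]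
    -- The spare last term only keeps the first constant positive when `Δ = 0`.
    _ ≤ 8 * Δ * (9 * (τ ^ 2 * L / T) + τ * r + s) + (4 * s + 392 * (τ * r)) + τ ^ 2 * L / T := by
      linarith
    _ = _ := by ring

end Assembly

end GTFT

theorem mainTheorem2 (Δ : ℝ) :
    ∃ γ₇ γ₈ γ₉ : ℝ, 0 < γ₇ ∧ 0 < γ₈ ∧ 0 < γ₉ ∧
      ∀ (n d τ T : ℕ) (L σ : ℝ)
        (Ξ : Fin n → Type*) [∀ i, MeasurableSpace (Ξ i)]
        (P : ∀ i, Measure (Ξ i)) [∀ i, IsProbabilityMeasure (P i)]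
        (F : ∀ i, GTFT.Vec d → Ξ i → ℝ)
        (Ω : Type*) [MeasurableSpace Ω] (μ : Measure Ω) [IsProbabilityMeasure μ]
        (W V U : ℕ → Matrix (Fin n) (Fin n) ℝ)
        (x₀ : Ω → Fin n → GTFT.Vec d) (ξ : ℕ → ∀ i, Ω → Ξ i)
        (x : ℕ → Ω → Fin n → GTFT.Vec d),
        1 ≤ n → τ ≤ T →
        GTFT.LossRegular P F →
        GTFT.SmoothProblem P F L →
        GTFT.FiniteTimeConsensus τ W →
        (∀ k < τ, V k ∈ doublyStochastic ℝ (Fin n)) →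
        (∀ k ≤ τ, U k ∈ doublyStochastic ℝ (Fin n)) →
        x = GTFT.iterates F τ W V U (GTFT.stepSize n τ T L σ) x₀ ξ →
        GTFT.NoiseAssumption μ P F x ξ σ →
        (∫⁻ ω, ENNReal.ofReal (GTFT.obj P F (GTFT.avg (x 0 ω)) - GTFT.optVal P F) ∂μ
          ≤ ENNReal.ofReal Δ) →
        (∑ k ∈ Finset.range (τ + 1), GTFT.consensusError μ (x k) = 0) →
        ((T : ℝ≥0∞) + 1)⁻¹ * ∑ k ∈ Finset.range (T + 1),
            (GTFT.meanSq μ (fun ω => GTFT.avg (GTFT.trueGrad P F (x k ω)))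
              + GTFT.meanSq μ (fun ω => gradient (GTFT.obj P F) (GTFT.avg (x k ω))))
          ≤ ENNReal.ofReal
              (γ₇ * (τ : ℝ) ^ 2 * L / T
                + γ₈ * τ * (L * σ / T) ^ (2 / 3 : ℝ)
                + γ₉ * (L * σ ^ 2 / (n * T)) ^ (1 / 2 : ℝ)) := by
  refine ⟨72 * max Δ 0 + 1, 8 * max Δ 0 + 392, 8 * max Δ 0 + 4, by positivity, by positivity,
    by positivity, ?_⟩
  intro n d τ T L σ Ξ _ P _ F Ω _ μ _ W V U x₀ ξ x hn hT hF hS hW hV hU hx hN hΔ hc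
  -- Iteration `t = τ - 1` is the last but one of the consensual phase; both it and `τ` are needed
  -- to restart the tracking.
  obtain ⟨t, rfl⟩ : ∃ t, τ = t + 1 := ⟨τ - 1, by have := hW.one_le; omega⟩
  subst hx
  have hα := GTFT.stepSize_pos hn hW.one_le (hW.one_le.trans hT) hS.pos hN.pos
  have hrun := GTFT.trackedRun_iterates hF hS hn hα.ne' hW hV hU hN hc
  obtain ⟨h0, hΔ'⟩ := GTFT.integrable_obj_of_lintegral hS
    (GTFT.measurable_avg.comp (hrun.measurable 0)) hΔ
  exact hrun.average_le hS hn hN.pos (le_max_right _ _) h0 hΔ' hT
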